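/- For $T\subseteq\mathbb R$ let $\mathcal P(T)$ be the set of Borel probability measures on $T$ all of whose moments exist, and let $\mathcal M_N(T)=\{(m_1(\mu),\dots,m_N(\mu)) : \mu\in\mathcal P(T)\}\subset\mathbb R^N$, where $m_k(\mu)=\int x^k\,d\mu$. For a compact interval $[a,b]$, $a<b$, and $\vec m=(m_1,\dots,m_N)$ let $m_k^-$ and $m_k^+$ be the minimum and the maximum of $m_k(\mu)$ over all $\mu\in\mathcal P([a,b])$ with $m_i(\mu)=m_i$ for $1\le i\le k-1$. For real parameters $\gamma=(\gamma_k)$, $\delta=(\delta_k)$ with $\gamma_k,\delta_k>-1$ consider on $\mathcal M_N([a,b])$ the density $$f_N^{(\gamma,\delta)}(\vec m)=c_N\prod_{k=1}^N\Big(\frac{m_k-m_k^-}{m_k^+-m_k^-}\Big)^{\gamma_k}\Big(\frac{m_k^+-m_k}{m_k^+-m_k^-}\Big)^{\delta_k}\mathbf 1_{\{m_k^-<m_k<m_k^+\}},$$ $$c_N=\Big\{(b-a)^{N(N+1)/2}\prod_{k=1}^N\int_0^1x^{N-k+\gamma_k}(1-x)^{N-k+\delta_k}\,dx\Big\}^{-1}$$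 (with value $0$ outside the interior of $\mathcal M_N([a,b])$). For $\vec m=(m_1,\dots,m_{2n-1})$ in the interior of $\mathcal M_{2n-1}(\mathbb R)$ let $P_0,\dots,P_n$ be the associated monic orthogonal polynomials and let $b_1,a_1,\dots,a_{n-1},b_n$ be the coefficients in their recurrence $xP_k=P_{k+1}+b_{k+1}P_k+a_kP_{k-1}$; equivalently, for any $\mu$ with these moments, $\int x^kP_k\,d\mu=a_1\cdots a_k$ ($1\le k\le n-1$) and $\int x^{k+1}P_k\,d\mu=a_1\cdots a_k(b_1+\dots+b_{k+1})$ ($0\le k\le n-1$). **Theorem.** Let $n\ge1$, let $\delta_k>0$ for $1\le k\le 2n-1$ and $\gamma_k>-1$ for $1\le k\le n-1$. For $s>0$ let $f_{2n-1}^{(\gamma^{(s)},\delta^{(s)})}$ be the density above on $\mathcal M_{2n-1}([-s,s])$, where, as $s\to\infty$, $$\gamma^{(s)}_{2k-1}=\delta_{2k-1}s^2+o(1),\qquad \delta^{(s)}_{2k-1}=\delta_{2k-1}s^2+o(1)\qquad(1\le k\le n),$$ $$\gamma^{(s)}_{2k}=\gamma_k+o(1),\qquad \delta^{(s)}_{2k}=\delta_{2k}s^2+o(s^2)\qquad(1\le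 k\le n-1).$$ Then, as $s\to\infty$, $f_{2n-1}^{(\gamma^{(s)},\delta^{(s)})}$ converges pointwise on $\mathbb R^{2n-1}$ to the function $$h_{2n-1}^{(\gamma,\delta)}(\vec m)=\prod_{k=1}^n\sqrt{\frac{\delta_{2k-1}}{\pi}}\,e^{-\delta_{2k-1}b_k(\vec m)^2}\ \prod_{k=1}^{n-1}\frac{\delta_{2k}^{\gamma_k+2n-2k}}{\Gamma(\gamma_k+2n-2k)}\,a_k(\vec m)^{\gamma_k}e^{-\delta_{2k}a_k(\vec m)}\mathbf 1_{\{a_k(\vec m)>0\}}$$ (which is $0$ outside the interior of $\mathcal M_{2n-1}(\mathbb R)$). Moreover, $h_{2n-1}^{(\gamma,\delta)}$ is a probability density with respect to Lebesgue measure on $\mathcal M_{2n-1}(\mathbb R)$: it is measurable, nonnegative, vanishes outside $\mathcal M_{2n-1}(\mathbb R)$, and has integral $1$. -/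

import Mathlib

open MeasureTheory Filter Asymptotics Polynomial Topology

noncomputable section

/-- `μ` is a probability measure on `T ⊆ ℝ` (viewed as a measure on `ℝ`) all of whose moments exist. -/
structure IsProbOn (T : Set ℝ) (μ : Measure ℝ) : Prop where
  isProb : IsProbabilityMeasure μ
  supp : μ Tᶜ = 0
  integrable_pow : ∀ k : ℕ, Integrable (fun x : ℝ => x ^ k) μ

/-- The `N`-th moment space of `T`. The coordinate with index `i : Fin N` is the moment of
order `i + 1`. -/
def momentSpace (T : Set ℝ) (N : ℕ) : Set (Fin N → ℝ) :=
  {m | ∃ μ : Measure ℝ, IsProbOn T μ ∧ ∀ i : Fin N, ∫ x, x ^ ((i : ℕ) + 1) ∂μ = m i}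

/-- The entry `m_j` of a moment vector `(m_1, …, m_N)`, with `m_0 = 1`
(and the value `0`, never used, for `j > N`). -/
def mom {N : ℕ} (m : Fin N → ℝ) (j : ℕ) : ℝ :=
  if j = 0 then 1 else if h : j - 1 < N then m ⟨j - 1, h⟩ else 0

/-- All possible `k`-th moments of probability measures on `T` with prescribed moments
`m_1, …, m_{k-1}`. -/
def nextMoments (T : Set ℝ) {N : ℕ} (m : Fin N → ℝ) (k : ℕ) : Set ℝ :=
  {y | ∃ μ : Measure ℝ, IsProbOn T μ ∧ (∀ i ∈ Finset.Icc 1 (k - 1), ∫ x, x ^ i ∂μ = mom m i) ∧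
    ∫ x, x ^ k ∂μ = y}

/-- The lower bound `m_k^-` on `[a,b]`. -/
def lowerMom (a b : ℝ) {N : ℕ} (m : Fin N → ℝ) (k : ℕ) : ℝ := sInf (nextMoments (Set.Icc a b) m k)

/-- The upper bound `m_k^+` on `[a,b]`. -/
def upperMom (a b : ℝ) {N : ℕ} (m : Fin N → ℝ) (k : ℕ) : ℝ := sSup (nextMoments (Set.Icc a b) m k)

/-- The normalizing constant of the density on the `N`-th moment space of `[a,b]`. -/
def normConst (a b : ℝ) (N : ℕ) (γ δ : ℕ → ℝ) : ℝ :=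
  ((b - a) ^ (N * (N + 1) / 2) *
    ∏ k ∈ Finset.Icc 1 N,
      ∫ x in (0 : ℝ)..1, x ^ ((N : ℝ) - k + γ k) * (1 - x) ^ ((N : ℝ) - k + δ k))⁻¹

open Classical in
/-- The density `f_N^{(γ,δ)}` on the `N`-th moment space of `[a,b]`. -/
def momentDensity (a b : ℝ) (N : ℕ) (γ δ : ℕ → ℝ) (m : Fin N → ℝ) : ℝ :=
  normConst a b N γ δ *
    ∏ k ∈ Finset.Icc 1 N,
      (((mom m k - lowerMom a b m k) / (upperMom a b m k - lowerMom a b m k)) ^ (γ k) *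
        ((upperMom a b m k - mom m k) / (upperMom a b m k - lowerMom a b m k)) ^ (δ k) *
        if lowerMom a b m k < mom m k ∧ mom m k < upperMom a b m k then 1 else 0)

/-- The moment functional `X ^ j ↦ m_j`; it is the integral against any measure with moments
`m_1, …, m_N` on polynomials of degree at most `N`. -/
def momFunctional {N : ℕ} (m : Fin N → ℝ) (p : ℝ[X]) : ℝ := p.sum fun j c => c * mom m j

/-- The Hankel determinant `det (m_{i+j})_{0 ≤ i, j < k}`. -/
def hankelDet {N : ℕ} (m : Fin N → ℝ) (k : ℕ) : ℝ :=
  (Matrix.of fun i j : Fin k => mom m ((i : ℕ) + (j : ℕ))).det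

/-- The `k`-th monic orthogonal polynomial `P_k`: the determinant with rows
`(m_i, …, m_{i+k-1}, X ^ i)`, `0 ≤ i ≤ k`, divided by the Hankel determinant of size `k`. -/
def orthPoly {N : ℕ} (m : Fin N → ℝ) (k : ℕ) : ℝ[X] :=
  C (hankelDet m k)⁻¹ *
    (Matrix.of fun i j : Fin (k + 1) =>
      if (j : ℕ) < k then C (mom m ((i : ℕ) + (j : ℕ))) else X ^ (i : ℕ)).det

/-- The recursion coefficient `a_k`, `k ≥ 1`, determined by `∫ x ^ k P_k = a_1 ⋯ a_k`. -/
def recA {N : ℕ} (m : Fin N → ℝ) (k : ℕ) : ℝ :=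
  momFunctional m (X ^ k * orthPoly m k) / momFunctional m (X ^ (k - 1) * orthPoly m (k - 1))

/-- The partial sum `b_1 + ⋯ + b_k`, determined by
`∫ x ^ (k + 1) P_k = a_1 ⋯ a_k (b_1 + ⋯ + b_{k+1})`, where `a_1 ⋯ a_k = ∫ x ^ k P_k`. -/
def recBSum {N : ℕ} (m : Fin N → ℝ) : ℕ → ℝ
  | 0 => 0
  | k + 1 =>
    momFunctional m (X ^ (k + 1) * orthPoly m k) / momFunctional m (X ^ k * orthPoly m k)

/-- The recursion coefficient `b_k`, `k ≥ 1`. -/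
def recB {N : ℕ} (m : Fin N → ℝ) (k : ℕ) : ℝ := recBSum m k - recBSum m (k - 1)

open Classical in
/-- The limit function `h_{2n-1}^{(γ,δ)}`. The condition that all `a_k` be positive describes the
interior of the moment space; outside of it the function vanishes. -/
def limitDensity (n : ℕ) (γ δ : ℕ → ℝ) (m : Fin (2 * n - 1) → ℝ) : ℝ :=
  (∏ k ∈ Finset.Icc 1 n,
    √(δ (2 * k - 1) / Real.pi) * Real.exp (-(δ (2 * k - 1) * recB m k ^ 2))) *
  ∏ k ∈ Finset.Icc 1 (n - 1),
    (δ (2 * k) ^ (γ k + 2 * n - 2 * k) / Real.Gamma (γ k + 2 * n - 2 * k) *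
      recA m k ^ (γ k) * Real.exp (-(δ (2 * k) * recA m k)) *
      if 0 < recA m k then 1 else 0)

/-- `h` is a probability density (with respect to Lebesgue measure) concentrated on `M`. -/
structure IsDensityOn {N : ℕ} (M : Set (Fin N → ℝ)) (h : (Fin N → ℝ) → ℝ) : Prop where
  measurable : Measurable h
  nonneg : ∀ m, 0 ≤ h m
  zero_off : ∀ m, m ∉ M → h m = 0
  lintegral_eq_one : ∫⁻ m, ENNReal.ofReal (h m) = 1

end

/-! In the canonical moments `p_k = (m_k - m_k⁻) / (m_k⁺ - m_k⁻)` the density is a product of beta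
weights, so everything rests on the behaviour of `p_k` on `[-s, s]` for a fixed strictly positive
vector `m`. The claim is that `p_{2k-1} = 1/2 + b_k/(2s) + o(1/s)` and `p_{2k} = a_k/s² + o(1/s²)`.
Symmetric beta weights with exponents about `δ s²` then become Gaussian in `b_k`, and the even
weights become gamma weights in `a_k`.

The extremal moments are found by duality. Hahn-Banach separation (`mem_momentSpace_Icc`) together
with the description of polynomials nonnegative on an interval (`mem_intervalCone_of_nonneg`)
reduces attainability of a next moment `y` to nonnegativity of quadratic forms: weights `s ± X` for
odd order, `1` and `s² - X²` for even order. Testing with `P_e²` bounds `y` from one side.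
Conversely, when `S` is large the form with weight `S + w` is almost minimised by `P_e` among monic
polynomials of degree `e`, with an error `O(1/S)` (`exists_lower_bound`). Hence
`tendsto_extremal_odd` and `extremal_even`, which give `canonicalMom_odd` and `canonicalMom_even`.

The beta integrals in the normalising constant, rescaled by the same substitutions, converge to
Gaussian and gamma integrals by dominated convergence. The leftover powers of `2` and `s` multiply
to exactly `(2s)^(N(N+1)/2)` (`scale_prod`). Where `m` is not strictly positive, both densities
vanish.

For the total mass, the passage from moments to `b_1, a_1, b_2, …` is triangular: given the earlier
moments, the next coordinate is affine in the next moment with slope `1/(a_1 ⋯ a_j)`. Integrating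
out the moments from the last to the first (`lintegral_prod_recCoord`) therefore gives each `a_k`
the Jacobian power `2n-1-2k` and leaves a product of normalised Gaussian and gamma integrals. -/

/-! ### Moment vectors as linear functionals on polynomials -/

/-- The moment functional as a linear map. -/
noncomputable def momLin {N : ℕ} (m : Fin N → ℝ) : ℝ[X] →ₗ[ℝ] ℝ where
  toFun := momFunctional m
  map_add' p q := by
    unfold momFunctional
    rw [Polynomial.sum_add_index] <;> intros <;> ring
  map_smul' c p := by
    unfold momFunctional
    rw [Polynomial.sum_smul_index _ _ _ (by intros; ring), smul_eq_mul, Polynomial.sum, Polynomial.sum,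
      Finset.mul_sum]
    simp [mul_assoc]

lemma momLin_C_mul {N : ℕ} (m : Fin N → ℝ) (c : ℝ) (p : ℝ[X]) :
    momLin m (C c * p) = c * momLin m p := by
  rw [← smul_eq_C_mul, map_smul, smul_eq_mul]

lemma momLin_X_pow {N : ℕ} (m : Fin N → ℝ) (j : ℕ) : momLin m (X ^ j) = mom m j := by
  change momFunctional m (X ^ j) = _
  simp [momFunctional, ← monomial_one_right_eq_X_pow, sum_monomial_index]

lemma mom_zero {N : ℕ} (m : Fin N → ℝ) : mom m 0 = 1 := by simp [mom]

lemma mom_succ {N : ℕ} (m : Fin N → ℝ) (i : Fin N) : mom m (i + 1) = m i := by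
  simp [mom]

lemma momLin_one {N : ℕ} (m : Fin N → ℝ) : momLin m 1 = 1 := by
  rw [← pow_zero X, momLin_X_pow, mom_zero]

lemma momLin_eq_sum {N : ℕ} (m : Fin N → ℝ) {p : ℝ[X]} {d : ℕ} (hp : p.natDegree ≤ d) :
    momLin m p = ∑ i ∈ Finset.range (d + 1), p.coeff i * mom m i := by
  conv_lhs => rw [p.as_sum_range' (d + 1) (by omega)]
  simp [map_sum, ← C_mul_X_pow_eq_monomial, momLin_C_mul, momLin_X_pow]

lemma momLin_sub_momLin {N N' : ℕ} (m : Fin N → ℝ) (m' : Fin N' → ℝ) {p : ℝ[X]} {d : ℕ}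
    (hp : p.natDegree ≤ d) (h : ∀ i < d, mom m i = mom m' i) :
    momLin m p = momLin m' p + p.coeff d * (mom m d - mom m' d) := by
  rw [momLin_eq_sum m hp, momLin_eq_sum m' hp, Finset.sum_range_succ, Finset.sum_range_succ,
    Finset.sum_congr rfl fun i hi => by rw [h i (Finset.mem_range.1 hi)]]
  ring

lemma momLin_congr {N N' : ℕ} (m : Fin N → ℝ) (m' : Fin N' → ℝ) {p : ℝ[X]} {d : ℕ}
    (hp : p.natDegree ≤ d) (h : ∀ i ≤ d, mom m i = mom m' i) :
    momLin m p = momLin m' p := by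
  rw [momLin_sub_momLin m m' hp fun i hi => h i hi.le, h d le_rfl, sub_self, mul_zero, add_zero]

/-! ### The determinants defining the orthogonal polynomials -/

/-- The Hankel determinant of size `k + 1` with its last column replaced by
`(m_i, …, m_{i+k})`. -/
noncomputable def hankelShift {N : ℕ} (m : Fin N → ℝ) (k i : ℕ) : ℝ :=
  (Matrix.of fun r c : Fin (k + 1) =>
    if (c : ℕ) < k then mom m ((r : ℕ) + (c : ℕ)) else mom m (i + (r : ℕ))).det

/-- The unnormalised orthogonal polynomial. -/
noncomputable def orthDet {N : ℕ} (m : Fin N → ℝ) (k : ℕ) : ℝ[X] :=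
  (Matrix.of fun i j : Fin (k + 1) =>
      if (j : ℕ) < k then C (mom m ((i : ℕ) + (j : ℕ))) else X ^ (i : ℕ)).det

/-- The cofactors of the last column of `orthDet`. -/
noncomputable def orthCofactor {N : ℕ} (m : Fin N → ℝ) (k : ℕ) (i : Fin (k + 1)) : ℝ :=
  (-1) ^ ((i : ℕ) + k) *
    (Matrix.of fun r c : Fin k => mom m ((i.succAbove r : ℕ) + (c : ℕ))).det

lemma orthDet_eq_sum {N : ℕ} (m : Fin N → ℝ) (k : ℕ) :
    orthDet m k = ∑ i : Fin (k + 1), C (orthCofactor m k i) * X ^ (i : ℕ) := by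
  unfold orthDet
  rw [Matrix.det_succ_column _ (Fin.last k)]
  refine Finset.sum_congr rfl fun i _ => ?_
  have : ((Matrix.of fun i j : Fin (k + 1) =>
      if (j : ℕ) < k then C (mom m ((i : ℕ) + (j : ℕ))) else X ^ (i : ℕ)).submatrix
        i.succAbove (Fin.last k).succAbove) =
      (C : ℝ →+* ℝ[X]).mapMatrix
        (Matrix.of fun r c : Fin k => mom m ((i.succAbove r : ℕ) + (c : ℕ))) := by
    ext1 r c
    simp
  rw [this, ← RingHom.map_det]
  simp [orthCofactor]

lemma hankelShift_eq_sum {N : ℕ} (m : Fin N → ℝ) (k i : ℕ) :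
    hankelShift m k i = ∑ r : Fin (k + 1), orthCofactor m k r * mom m (i + r) := by
  unfold hankelShift
  rw [Matrix.det_succ_column _ (Fin.last k)]
  refine Finset.sum_congr rfl fun r _ => ?_
  have : ((Matrix.of fun r c : Fin (k + 1) =>
      if (c : ℕ) < k then mom m ((r : ℕ) + (c : ℕ)) else mom m (i + (r : ℕ))).submatrix
        r.succAbove (Fin.last k).succAbove) =
        (Matrix.of fun r' c : Fin k => mom m ((r.succAbove r' : ℕ) + (c : ℕ))) := by
    ext1 r c
    simp
  rw [this]
  simp [orthCofactor]
  ring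

/-- The functional acts only on the last column of the determinant, where it turns powers of `X`
into moments. A repeated column then gives orthogonality to lower powers, and `i = k` gives a
quotient of consecutive Hankel determinants. -/
lemma momLin_X_pow_mul_orthPoly {N : ℕ} (m : Fin N → ℝ) (k i : ℕ) :
    momLin m (X ^ i * orthPoly m k) = (hankelDet m k)⁻¹ * hankelShift m k i := by
  have : X ^ i * orthPoly m k = C (hankelDet m k)⁻¹ * (X ^ i * orthDet m k) := by
    simp only [orthPoly, orthDet]; ring
  rw [this, momLin_C_mul, orthDet_eq_sum, hankelShift_eq_sum, Finset.mul_sum, map_sum]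
  congr 1
  refine Finset.sum_congr rfl fun r _ => ?_
  rw [show X ^ i * (C (orthCofactor m k r) * X ^ (r : ℕ)) =
    C (orthCofactor m k r) * X ^ (i + r : ℕ) by ring, momLin_C_mul, momLin_X_pow]

lemma hankelShift_of_lt {N : ℕ} (m : Fin N → ℝ) {k i : ℕ} (h : i < k) : hankelShift m k i = 0 := by
  refine Matrix.det_zero_of_column_eq (i := ⟨i, by omega⟩) (j := Fin.last k) ?_ fun r => ?_
  · intro h'
    have := congrArg Fin.val h'
    simp at this
    omega
  · simp [h, add_comm]

lemma hankelShift_self {N : ℕ} (m : Fin N → ℝ) (k : ℕ) :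
    hankelShift m k k = hankelDet m (k + 1) := by
  unfold hankelShift hankelDet
  congr 1
  ext r c
  simp only [Matrix.of_apply]
  split_ifs with h
  · rfl
  · rw [add_comm, show (c : ℕ) = k by omega]

lemma orthPoly_zero {N : ℕ} (m : Fin N → ℝ) : orthPoly m 0 = 1 := by
  simp [orthPoly, hankelDet]

lemma natDegree_orthPoly_le {N : ℕ} (m : Fin N → ℝ) (k : ℕ) : (orthPoly m k).natDegree ≤ k := by
  change (C _ * orthDet m k).natDegree ≤ k
  refine (natDegree_C_mul_le _ _).trans ?_
  rw [orthDet_eq_sum]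
  refine natDegree_sum_le_of_forall_le _ _ fun i _ => ?_
  exact (natDegree_C_mul_X_pow_le _ _).trans (by omega)

lemma orthCofactor_last {N : ℕ} (m : Fin N → ℝ) (k : ℕ) :
    orthCofactor m k (Fin.last k) = hankelDet m k := by
  simp [orthCofactor, hankelDet]

lemma coeff_orthPoly_self {N : ℕ} (m : Fin N → ℝ) {k : ℕ} (h : hankelDet m k ≠ 0) :
    (orthPoly m k).coeff k = 1 := by
  change (C _ * orthDet m k).coeff k = 1
  rw [coeff_C_mul, orthDet_eq_sum, finsetSum_coeff, Finset.sum_eq_single (Fin.last k)]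
  · simp [orthCofactor_last, h]
  · intro b _ hb
    rw [coeff_C_mul, coeff_X_pow, if_neg, mul_zero]
    intro h'
    exact hb (Fin.ext h'.symm)
  · simp

lemma mom_congr_orthPoly {N N' : ℕ} (m : Fin N → ℝ) (m' : Fin N' → ℝ) (k : ℕ)
    (h : ∀ i < 2 * k, mom m i = mom m' i) : orthPoly m k = orthPoly m' k := by
  have h1 : hankelDet m k = hankelDet m' k := by
    unfold hankelDet
    congr 1
    ext r c
    exact h _ (by omega)
  unfold orthPoly
  rw [h1]
  congr 2
  ext1 r c
  simp only [Matrix.of_apply]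
  split_ifs with hc
  · rw [h _ (by omega)]
  · rfl

/-- `∫ x ^ k P_k`, which equals `a_1 ⋯ a_k` and also `∫ P_k ^ 2`. -/
noncomputable def orthNorm {N : ℕ} (m : Fin N → ℝ) (k : ℕ) : ℝ := momLin m (X ^ k * orthPoly m k)

lemma orthNorm_zero {N : ℕ} (m : Fin N → ℝ) : orthNorm m 0 = 1 := by
  simp [orthNorm, orthPoly_zero, momLin_one]

lemma orthNorm_eq {N : ℕ} (m : Fin N → ℝ) (k : ℕ) :
    orthNorm m k = (hankelDet m k)⁻¹ * hankelDet m (k + 1) := by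
  rw [orthNorm, momLin_X_pow_mul_orthPoly, hankelShift_self]

lemma recA_eq {N : ℕ} (m : Fin N → ℝ) (k : ℕ) :
    recA m k = orthNorm m k / orthNorm m (k - 1) := rfl

lemma recBSum_succ {N : ℕ} (m : Fin N → ℝ) (k : ℕ) :
    recBSum m (k + 1) = momLin m (X ^ (k + 1) * orthPoly m k) / orthNorm m k := rfl

lemma orthNorm_succ {N : ℕ} (m : Fin N → ℝ) {k : ℕ} (h : orthNorm m k ≠ 0) :
    orthNorm m (k + 1) = orthNorm m k * recA m (k + 1) := by
  rw [recA_eq, Nat.add_sub_cancel]; field_simp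

lemma orthNorm_pos_of_recA_pos {N : ℕ} (m : Fin N → ℝ) {k : ℕ}
    (h : ∀ j ∈ Finset.Icc 1 k, 0 < recA m j) : 0 < orthNorm m k := by
  induction k with
  | zero => simp [orthNorm_zero]
  | succ k ih =>
    have := ih fun j hj => h j (by simp at hj ⊢; omega)
    rw [orthNorm_succ _ this.ne']
    exact mul_pos this (h _ (by simp))

lemma hankelDet_pos_of_orthNorm_pos {N : ℕ} (m : Fin N → ℝ) {k : ℕ}
    (h : ∀ j < k, 0 < orthNorm m j) : 0 < hankelDet m k := by
  induction k with
  | zero => simp [hankelDet]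
  | succ k ih =>
    have h1 := ih fun j hj => h j (by omega)
    have h2 := h k (by omega)
    rw [orthNorm_eq] at h2
    exact (pos_iff_pos_of_mul_pos h2).1 (inv_pos.2 h1)

/-- The vector `m` is strictly positive up to order `n`: this means that the functional is
positive definite on polynomials of degree `< n`. -/
def PosUpTo {N : ℕ} (m : Fin N → ℝ) (n : ℕ) : Prop := ∀ j < n, 0 < orthNorm m j

lemma PosUpTo.mono {N : ℕ} {m : Fin N → ℝ} {n n' : ℕ} (h : PosUpTo m n) (hn : n' ≤ n) :
    PosUpTo m n' := fun j hj => h j (hj.trans_le hn)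

lemma PosUpTo.coeff_orthPoly {N : ℕ} {m : Fin N → ℝ} {n k : ℕ} (h : PosUpTo m n) (hk : k ≤ n) :
    (orthPoly m k).coeff k = 1 :=
  coeff_orthPoly_self m (hankelDet_pos_of_orthNorm_pos m (h.mono hk)).ne'

/-- The norms are the partial products of the `a_j`, starting from `orthNorm m 0 = 1`. Thus the
indicator in the limit density is exactly strict positivity, with no separate nonvanishing
assumption on the denominators. -/
lemma posUpTo_iff_recA_pos {N : ℕ} (m : Fin N → ℝ) (n : ℕ) :
    PosUpTo m n ↔ ∀ k ∈ Finset.Icc 1 (n - 1), 0 < recA m k := by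
  constructor
  · intro h k hk
    simp at hk
    exact div_pos (h _ (by omega)) (h _ (by omega))
  · intro h j hj
    exact orthNorm_pos_of_recA_pos m fun i hi => h i (by simp at hi ⊢; omega)

/-! ### Orthogonality and the quadratic form of a positive functional -/

lemma momLin_orthPoly_mul_of_lt {N : ℕ} (m : Fin N → ℝ) {k : ℕ} {r : ℝ[X]}
    (hr : r.degree < k) : momLin m (orthPoly m k * r) = 0 := by
  rcases eq_or_ne r 0 with rfl | h0
  · simp
  rw [r.as_sum_range' k ((natDegree_lt_iff_degree_lt h0).2 hr), Finset.mul_sum, map_sum]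
  refine Finset.sum_eq_zero fun i hi => ?_
  rw [← C_mul_X_pow_eq_monomial, show orthPoly m k * (C (r.coeff i) * X ^ i) =
    C (r.coeff i) * (X ^ i * orthPoly m k) by ring, momLin_C_mul, momLin_X_pow_mul_orthPoly,
    hankelShift_of_lt m (Finset.mem_range.1 hi)]
  simp

lemma degree_sub_coeff_mul_lt {p q : ℝ[X]} {k : ℕ} (hp : p.natDegree ≤ k) (hc : p.coeff k = 1)
    (hq : q.natDegree ≤ k) : (q - C (q.coeff k) * p).degree < k := by
  rw [degree_lt_iff_coeff_zero]
  intro i hi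
  rw [coeff_sub, coeff_C_mul]
  rcases hi.eq_or_lt with rfl | hi
  · rw [hc]; ring
  · rw [coeff_eq_zero_of_natDegree_lt (hq.trans_lt hi), coeff_eq_zero_of_natDegree_lt
      (hp.trans_lt hi)]; ring

lemma exists_eq_orthPoly_add {N : ℕ} {m : Fin N → ℝ} {k : ℕ} (hm : PosUpTo m k) {q : ℝ[X]}
    (hq : q.natDegree ≤ k) :
    ∃ r : ℝ[X], r.degree < k ∧ q = C (q.coeff k) * orthPoly m k + r :=
  ⟨q - C (q.coeff k) * orthPoly m k,
    degree_sub_coeff_mul_lt (natDegree_orthPoly_le m k) (hm.coeff_orthPoly le_rfl) hq, by ring⟩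

lemma momLin_orthPoly_mul {N : ℕ} (m : Fin N → ℝ) {k : ℕ} {q : ℝ[X]} (hq : q.natDegree ≤ k) :
    momLin m (orthPoly m k * q) = q.coeff k * orthNorm m k := by
  have h := degree_sub_coeff_mul_lt (p := X ^ k) (by simp) (by simp) hq
  have h' := momLin_orthPoly_mul_of_lt m h
  rw [mul_sub, map_sub, show orthPoly m k * (C (q.coeff k) * X ^ k) =
    C (q.coeff k) * (X ^ k * orthPoly m k) by ring, momLin_C_mul, ← orthNorm] at h'
  linarith

lemma momLin_orthPoly_sq {N : ℕ} {m : Fin N → ℝ} {k : ℕ} (hm : PosUpTo m k) :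
    momLin m (orthPoly m k ^ 2) = orthNorm m k := by
  rw [sq, momLin_orthPoly_mul m (natDegree_orthPoly_le m k), hm.coeff_orthPoly le_rfl, one_mul]

/-- Expansion of a quadratic form along the decomposition `q = c P_k + r`. -/
lemma momLin_mul_sq_add {N : ℕ} (m : Fin N → ℝ) (w p r : ℝ[X]) (c : ℝ) :
    momLin m (w * (C c * p + r) ^ 2) =
      c ^ 2 * momLin m (w * p ^ 2) + 2 * c * momLin m (w * p * r) + momLin m (w * r ^ 2) := by
  rw [show w * (C c * p + r) ^ 2 = C (c ^ 2) * (w * p ^ 2) + C (2 * c) * (w * p * r) + w * r ^ 2 by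
    simp only [C_mul, C_pow, map_ofNat]; ring]
  simp only [map_add, momLin_C_mul]

lemma momLin_sq_add {N : ℕ} {m : Fin N → ℝ} {k : ℕ} (hm : PosUpTo m k) {r : ℝ[X]}
    (hr : r.degree < k) (c : ℝ) :
    momLin m ((C c * orthPoly m k + r) ^ 2) = c ^ 2 * orthNorm m k + momLin m (r ^ 2) := by
  have := momLin_mul_sq_add m 1 (orthPoly m k) r c
  simp only [one_mul] at this
  rw [this, momLin_orthPoly_mul_of_lt m hr, momLin_orthPoly_sq hm]
  ring

lemma momLin_sq_nonneg {N : ℕ} {m : Fin N → ℝ} {k : ℕ} (hm : PosUpTo m k) {r : ℝ[X]}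
    (hr : r.degree < k) : 0 ≤ momLin m (r ^ 2) := by
  induction k generalizing r with
  | zero =>
    have : r = 0 := by simpa using hr
    simp [this]
  | succ k ih =>
    have hr' : r.natDegree ≤ k := natDegree_le_iff_degree_le.2 (by
      rw [degree_lt_iff_coeff_zero] at hr
      rw [degree_le_iff_coeff_zero]
      exact fun i hi => hr i (by exact_mod_cast hi))
    obtain ⟨s, hs, h⟩ := exists_eq_orthPoly_add (hm.mono (Nat.le_succ k)) hr'
    rw [h, momLin_sq_add (hm.mono (Nat.le_succ k)) hs]
    have := ih (hm.mono (Nat.le_succ k)) hs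
    have := hm k (by omega)
    positivity

/-- Pythagoras for `q = c P_k + r`: the monic minimiser of `∫ q²` is `P_k`. This determines the
lower extremal moment of even order. -/
lemma coeff_sq_mul_orthNorm_le {N : ℕ} {m : Fin N → ℝ} {k : ℕ} (hm : PosUpTo m k) {q : ℝ[X]}
    (hq : q.natDegree ≤ k) : q.coeff k ^ 2 * orthNorm m k ≤ momLin m (q ^ 2) := by
  obtain ⟨r, hr, h⟩ := exists_eq_orthPoly_add hm hq
  conv_rhs => rw [h]
  rw [momLin_sq_add hm hr]
  linarith [momLin_sq_nonneg hm hr]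

/-- `∫ x P_k ^ 2 = (∫ P_k ^ 2) b_{k+1}`. -/
lemma momLin_X_mul_orthPoly_sq {N : ℕ} {m : Fin N → ℝ} {k : ℕ} (hm : PosUpTo m (k + 1)) :
    momLin m (X * orthPoly m k ^ 2) = orthNorm m k * recB m (k + 1) := by
  have hk := hm k (by omega)
  unfold recB
  rw [recBSum_succ]
  cases k with
  | zero =>
    simp [orthPoly_zero, orthNorm_zero, recBSum]
  | succ k =>
    have hk' := hm k (by omega)
    rw [Nat.add_sub_cancel, recBSum_succ]
    have hm1 : PosUpTo m (k + 1) := hm.mono (by omega)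
    have hm0 : PosUpTo m k := hm.mono (by omega)
    set p := orthPoly m (k + 1) with hp
    have hpd : p.natDegree ≤ k + 1 := natDegree_orthPoly_le m _
    have hpc : p.coeff (k + 1) = 1 := hm1.coeff_orthPoly le_rfl
    have hr := degree_sub_coeff_mul_lt (p := X ^ (k + 1)) (by simp) (by simp) hpd
    rw [hpc, C_1, one_mul] at hr
    set r := p - X ^ (k + 1) with hr'
    have hrd : r.natDegree ≤ k := natDegree_le_iff_degree_le.2 (by
      rw [degree_lt_iff_coeff_zero] at hr
      rw [degree_le_iff_coeff_zero]
      exact fun i hi => hr i (by exact_mod_cast hi))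
    have hpr : p = X ^ (k + 1) + r := by rw [hr']; ring
    -- the subleading coefficient
    have h1 : r.coeff k * orthNorm m k = - momLin m (X ^ (k + 1) * orthPoly m k) := by
      rw [← momLin_orthPoly_mul m hrd, hr', mul_sub, map_sub, mul_comm, hp,
        momLin_orthPoly_mul_of_lt m, mul_comm (orthPoly m k)]
      · ring
      · exact (degree_le_of_natDegree_le (natDegree_orthPoly_le m k)).trans_lt
          (by exact_mod_cast Nat.lt_succ_self k)
    have h2 : momLin m (p * (X * r)) = r.coeff k * orthNorm m (k + 1) := by
      rw [hp, momLin_orthPoly_mul m (q := X * r), coeff_X_mul]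
      exact (natDegree_mul_le.trans (by rw [natDegree_X]; omega))
    -- One factor of the square is split as `X ^ (k + 1) + r`. The leading part yields the new
    -- partial sum of the `b`'s, and the subleading coefficient of `p`, by `h1`, is minus the
    -- previous one.
    have h3 : momLin m (X * p ^ 2) = momLin m (X ^ (k + 1 + 1) * p) + momLin m (p * (X * r)) := by
      rw [← map_add]
      congr 1
      nth_rewrite 2 [hpr]
      rw [hpr]; ring
    rw [h3, h2]
    field_simp
    linear_combination orthNorm m (k + 1) * h1

/-! ### Polynomials nonnegative on an interval -/

/-- The cone spanned by the products `q ^ 2 (X - a) ^ i (b - X) ^ j` of degree at most `d`. -/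
noncomputable def intervalCone (a b : ℝ) (d : ℕ) : AddSubmonoid ℝ[X] :=
  AddSubmonoid.closure {p | ∃ (q : ℝ[X]) (i j : ℕ), 2 * q.natDegree + i + j ≤ d ∧
    p = q ^ 2 * (X - C a) ^ i * (C b - X) ^ j}

lemma mul_mem_intervalCone {a b : ℝ} {d e : ℕ} {p : ℝ[X]} (hp : p ∈ intervalCone a b d)
    (q : ℝ[X]) (i j : ℕ) (h : d + 2 * q.natDegree + i + j ≤ e) :
    q ^ 2 * (X - C a) ^ i * (C b - X) ^ j * p ∈ intervalCone a b e := by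
  induction hp using AddSubmonoid.closure_induction with
  | mem x hx =>
    obtain ⟨q', i', j', h', rfl⟩ := hx
    refine AddSubmonoid.subset_closure ⟨q * q', i + i', j + j', ?_, by ring⟩
    have := natDegree_mul_le (p := q) (q := q')
    omega
  | zero => simp
  | add x y _ _ hx hy => rw [mul_add]; exact add_mem hx hy

/-- Dividing by the positive factor works away from `r`; density and continuity recover the point
`r` itself. -/
lemma nonneg_of_mul_nonneg_on {a b : ℝ} {p q : ℝ[X]} (r : ℝ)
    (hp : ∀ x ∈ Set.Ioo a b, x ≠ r → 0 < p.eval x)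
    (h : ∀ x ∈ Set.Ioo a b, 0 ≤ (p * q).eval x) : ∀ x ∈ Set.Ioo a b, 0 ≤ q.eval x := by
  intro x hx
  have hx' : x ∈ closure (Set.Ioo a b ∩ {r}ᶜ) := by
    have : Dense ({r}ᶜ : Set ℝ) := dense_compl_singleton r
    exact this.open_subset_closure_inter isOpen_Ioo hx
  have hc : IsClosed {x : ℝ | 0 ≤ q.eval x} := isClosed_le continuous_const q.continuous
  refine closure_minimal ?_ hc hx'
  rintro y ⟨hy, hyr⟩
  have h1 := h y hy
  rw [eval_mul] at h1
  exact nonneg_of_mul_nonneg_right h1 (hp y hy hyr)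

/-- A Lukács-type representation, by splitting off roots. The degree bound must be kept, since the
functional is controlled only up to the order of the moment in question. -/
lemma mem_intervalCone_of_nonneg {a b : ℝ} (hab : a < b) {d : ℕ} {p : ℝ[X]} (hd : p.natDegree ≤ d)
    (hp : ∀ x ∈ Set.Ioo a b, 0 ≤ p.eval x) : p ∈ intervalCone a b d := by
  induction h : p.natDegree using Nat.strong_induction_on generalizing p d with
  | _ n ih =>
  subst h
  rcases eq_or_ne p 0 with rfl | hp0
  · exact zero_mem _
  by_cases hdeg : p.natDegree = 0
  · rw [natDegree_eq_zero] at hdeg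
    obtain ⟨c, rfl⟩ := hdeg
    have hc : 0 ≤ c := by
      have := hp ((a + b) / 2) ⟨by linarith, by linarith⟩
      simpa using this
    refine AddSubmonoid.subset_closure ⟨C (√c), 0, 0, by simp, ?_⟩
    rw [← C_pow, Real.sq_sqrt hc]; ring
  have hdeg' : p.degree ≠ 0 := fun h => hdeg (natDegree_eq_of_degree_eq_some h)
  by_cases hroot : ∃ r : ℝ, p.eval r = 0
  · obtain ⟨r, hr⟩ := hroot
    obtain ⟨q, hq⟩ := dvd_iff_isRoot.2 hr
    have hq0 : q ≠ 0 := by rintro rfl; simp at hq; exact hp0 hq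
    have hdq : p.natDegree = q.natDegree + 1 := by
      rw [hq, natDegree_mul (X_sub_C_ne_zero r) hq0, natDegree_X_sub_C, add_comm]
    -- For a root outside the open interval the linear factor is a nonnegative combination of a
    -- generator and a constant: `X - r = (X - a) + (a - r)`, and symmetrically at `b`.
    rcases le_or_gt r a with hra | hra
    · have hqn : ∀ x ∈ Set.Ioo a b, 0 ≤ q.eval x := by
        refine nonneg_of_mul_nonneg_on (p := X - C r) r (fun x hx _ => ?_) (by rwa [← hq])
        simp; linarith [hx.1]
      have hm := ih q.natDegree (by omega) (d := d - 1) (by omega) hqn rfl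
      have e : p = 1 ^ 2 * (X - C a) ^ 1 * (C b - X) ^ 0 * q +
          (C √(a - r)) ^ 2 * (X - C a) ^ 0 * (C b - X) ^ 0 * q := by
        rw [← C_pow, Real.sq_sqrt (by linarith), C_sub, hq]; ring
      rw [e]
      exact add_mem (mul_mem_intervalCone hm _ _ _ (by simp; omega))
        (mul_mem_intervalCone hm _ _ _ (by simp))
    rcases le_or_gt b r with hrb | hrb
    · have hqn : ∀ x ∈ Set.Ioo a b, 0 ≤ (-q).eval x := by
        refine nonneg_of_mul_nonneg_on (p := C r - X) r (fun x hx _ => ?_) (fun x hx => ?_)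
        · simp; linarith [hx.2]
        · have := hp x hx
          rw [hq] at this
          simp at this ⊢; linarith
      have hm := ih (-q).natDegree (by simp; omega) (d := d - 1) (by simp; omega) hqn rfl
      have e : p = 1 ^ 2 * (X - C a) ^ 0 * (C b - X) ^ 1 * (-q) +
          (C √(r - b)) ^ 2 * (X - C a) ^ 0 * (C b - X) ^ 0 * (-q) := by
        rw [← C_pow, Real.sq_sqrt (by linarith), C_sub, hq]; ring
      rw [e]
      exact add_mem (mul_mem_intervalCone hm _ _ _ (by simp; omega))
        (mul_mem_intervalCone hm _ _ _ (by simp))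
    -- A root inside the interval is at least double, because the quotient is nonpositive to its
    -- left and nonnegative to its right.
    · have hqr : q.eval r = 0 := by
        apply le_antisymm
        · have hqn : ∀ x ∈ Set.Ioo a r, 0 ≤ (-q).eval x := by
            refine nonneg_of_mul_nonneg_on (p := C r - X) r (fun x hx _ => ?_) (fun x hx => ?_)
            · simp; linarith [hx.2]
            · have := hp x ⟨hx.1, hx.2.trans hrb⟩
              rw [hq] at this
              simp at this ⊢; linarith
          have hc : IsClosed {x : ℝ | 0 ≤ (-q).eval x} := isClosed_le continuous_const (-q).continuous
          have : r ∈ closure (Set.Ioo a r) := by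
            rw [closure_Ioo hra.ne]; exact Set.right_mem_Icc.2 hra.le
          have h0 : 0 ≤ (-q).eval r := closure_minimal hqn hc this
          simpa using h0
        · have hqn : ∀ x ∈ Set.Ioo r b, 0 ≤ q.eval x := by
            refine nonneg_of_mul_nonneg_on (p := X - C r) r (fun x hx _ => ?_) (fun x hx => ?_)
            · simp; linarith [hx.1]
            · rw [← hq]; exact hp x ⟨hra.trans hx.1, hx.2⟩
          have hc : IsClosed {x : ℝ | 0 ≤ q.eval x} := isClosed_le continuous_const q.continuous
          have : r ∈ closure (Set.Ioo r b) := by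
            rw [closure_Ioo hrb.ne]; exact Set.left_mem_Icc.2 hrb.le
          exact closure_minimal hqn hc this
      obtain ⟨t, ht⟩ := dvd_iff_isRoot.2 hqr
      have ht0 : t ≠ 0 := by rintro rfl; simp at ht; exact hq0 ht
      have hdt : q.natDegree = t.natDegree + 1 := by
        rw [ht, natDegree_mul (X_sub_C_ne_zero r) ht0, natDegree_X_sub_C, add_comm]
      have htn : ∀ x ∈ Set.Ioo a b, 0 ≤ t.eval x := by
        refine nonneg_of_mul_nonneg_on (p := (X - C r) ^ 2) r (fun x hx hxr => ?_) (fun x hx => ?_)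
        · have : x - r ≠ 0 := sub_ne_zero.2 hxr
          simp; positivity
        · have := hp x hx
          rw [hq, ht] at this
          simpa [sq, mul_assoc] using this
      have hm := ih t.natDegree (by omega) (d := d - 2) (by omega) htn rfl
      have e : p = (X - C r) ^ 2 * (X - C a) ^ 0 * (C b - X) ^ 0 * t := by
        rw [hq, ht]; ring
      rw [e]
      exact mul_mem_intervalCone hm _ _ _ (by rw [natDegree_X_sub_C]; omega)
  · push Not at hroot
    -- Without real roots, a conjugate pair contributes the factor `(X - Re z)² + (Im z)²`, a sum of
    -- two squares.
    obtain ⟨z, hz⟩ := IsAlgClosed.exists_aeval_eq_zero ℂ p hdeg'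
    have hzim : z.im ≠ 0 := by
      intro h0
      have : z = (z.re : ℂ) := by apply Complex.ext <;> simp [h0]
      rw [this, show (z.re : ℂ) = algebraMap ℝ ℂ z.re from rfl, aeval_algebraMap_apply] at hz
      simp at hz
      exact hroot _ hz
    obtain ⟨q, hq⟩ := quadratic_dvd_of_aeval_eq_zero_im_ne_zero p hz hzim
    have e1 : (X ^ 2 - C (2 * z.re) * X + C (‖z‖ ^ 2) : ℝ[X]) =
        (X - C z.re) ^ 2 + C (z.im) ^ 2 := by
      have : ‖z‖ ^ 2 = z.re ^ 2 + z.im ^ 2 := by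
        rw [← Complex.normSq_eq_norm_sq, Complex.normSq_apply]; ring
      rw [this]
      simp only [C_mul, C_add, C_pow, map_ofNat]; ring
    rw [e1] at hq
    have hq0 : q ≠ 0 := by rintro rfl; simp at hq; exact hp0 hq
    have hdeg2 : ((X - C z.re) ^ 2 + C (z.im) ^ 2 : ℝ[X]).natDegree = 2 := by
      rw [← C_pow, natDegree_add_C, natDegree_pow, natDegree_X_sub_C]
    have hne : ((X - C z.re) ^ 2 + C (z.im) ^ 2 : ℝ[X]) ≠ 0 := by
      intro h0; rw [h0] at hdeg2; simp at hdeg2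
    have hdq : p.natDegree = 2 + q.natDegree := by
      rw [hq, natDegree_mul hne hq0, hdeg2]
    have hqn : ∀ x ∈ Set.Ioo a b, 0 ≤ q.eval x := by
      refine nonneg_of_mul_nonneg_on (p := (X - C z.re) ^ 2 + C (z.im) ^ 2) 0
        (fun x hx _ => ?_) (by rwa [← hq])
      simp; positivity
    have hm := ih q.natDegree (by omega) (d := d - 2) (by omega) hqn rfl
    have e : p = (X - C z.re) ^ 2 * (X - C a) ^ 0 * (C b - X) ^ 0 * q +
        C (z.im) ^ 2 * (X - C a) ^ 0 * (C b - X) ^ 0 * q := by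
      rw [hq]; ring
    rw [e]
    exact add_mem (mul_mem_intervalCone hm _ _ _ (by rw [natDegree_X_sub_C]; omega))
      (mul_mem_intervalCone hm _ _ _ (by simp))

/-- Even powers of `X - a` and `b - X` are absorbed into the square, so only exponents `0` and `1`
need testing. -/
lemma nonneg_of_nonneg_on_generators {a b : ℝ} {d : ℕ} (ℓ : ℝ[X] →ₗ[ℝ] ℝ)
    (h : ∀ (q : ℝ[X]) (i j : ℕ), i < 2 → j < 2 → 2 * q.natDegree + i + j ≤ d →
      0 ≤ ℓ (q ^ 2 * (X - C a) ^ i * (C b - X) ^ j))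
    {p : ℝ[X]} (hp : p ∈ intervalCone a b d) : 0 ≤ ℓ p := by
  induction hp using AddSubmonoid.closure_induction with
  | mem x hx =>
    obtain ⟨q, i, j, hd, rfl⟩ := hx
    have := h (q * (X - C a) ^ (i / 2) * (C b - X) ^ (j / 2)) (i % 2) (j % 2)
      (Nat.mod_lt _ (by norm_num)) (Nat.mod_lt _ (by norm_num)) (by
        have h1 := natDegree_mul_le (p := q * (X - C a) ^ (i / 2)) (q := (C b - X) ^ (j / 2))
        have h2 := natDegree_mul_le (p := q) (q := (X - C a) ^ (i / 2))
        have h3 := natDegree_pow_le_of_le (i / 2) (natDegree_X_sub_C_le a)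
        have h4 : (C b - X : ℝ[X]).natDegree ≤ 1 := by
          rw [← natDegree_neg, neg_sub]; exact natDegree_X_sub_C_le b
        have h5 := natDegree_pow_le_of_le (j / 2) h4
        omega)
    convert! this using 2
    conv_lhs => rw [← Nat.div_add_mod i 2, ← Nat.div_add_mod j 2]
    ring
  | zero => simp
  | add x y _ _ hx hy => rw [map_add]; exact add_nonneg hx hy

/-- Positivity criterion for functionals of even order. -/
lemma nonneg_of_even {a b : ℝ} (hab : a < b) {j : ℕ} (ℓ : ℝ[X] →ₗ[ℝ] ℝ)
    (h0 : ∀ q : ℝ[X], q.natDegree ≤ j → 0 ≤ ℓ (q ^ 2))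
    (h1 : ∀ q : ℝ[X], q.natDegree + 1 ≤ j → 0 ≤ ℓ ((X - C a) * (C b - X) * q ^ 2))
    {p : ℝ[X]} (hd : p.natDegree ≤ 2 * j) (hp : ∀ x ∈ Set.Ioo a b, 0 ≤ p.eval x) : 0 ≤ ℓ p := by
  refine nonneg_of_nonneg_on_generators ℓ (fun q i k hi hk hq => ?_)
    (mem_intervalCone_of_nonneg hab hd hp)
  have hc : ∀ c : ℝ, ∀ x : ℝ[X], ℓ (C c * x) = c * ℓ x := fun c x => by
    rw [← smul_eq_C_mul, map_smul, smul_eq_mul]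
  have hba : (0 : ℝ) < (b - a)⁻¹ := by rw [inv_pos]; linarith
  -- This is `1 = ((X - a) + (b - X)) / (b - a)`. A generator with `i + k = 1` has its degree bound
  -- odd while `2 * j` is even, so one degree is spare and multiplying by this identity is
  -- affordable.
  have hba' : C (b - a)⁻¹ * (C b - C a) = (1 : ℝ[X]) := by
    rw [← C_sub, ← C_mul, inv_mul_cancel₀ (by linarith), C_1]
  have key : ∀ u : ℝ[X], u.natDegree ≤ 1 → q.natDegree + 1 ≤ j → 0 ≤ ℓ ((q * u) ^ 2) :=
    fun u hu hqj => h0 _ (by have := natDegree_mul_le (p := q) (q := u); omega)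
  interval_cases i <;> interval_cases k
  · simpa using h0 q (by omega)
  · rw [show q ^ 2 * (X - C a) ^ 0 * (C b - X) ^ 1 = C (b - a)⁻¹ * ((q * (C b - X)) ^ 2 +
      (X - C a) * (C b - X) * q ^ 2) by
        linear_combination (-(q ^ 2 * (C b - X))) * hba', hc, map_add]
    have := key (C b - X) (by rw [← natDegree_neg, neg_sub]; exact natDegree_X_sub_C_le b) (by omega)
    have := h1 q (by omega)
    positivity
  · rw [show q ^ 2 * (X - C a) ^ 1 * (C b - X) ^ 0 = C (b - a)⁻¹ * ((q * (X - C a)) ^ 2 +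
      (X - C a) * (C b - X) * q ^ 2) by
        linear_combination (-(q ^ 2 * (X - C a))) * hba', hc, map_add]
    have := key (X - C a) (natDegree_X_sub_C_le a) (by omega)
    have := h1 q (by omega)
    positivity
  · convert! h1 q (by omega) using 2
    ring

/-- Positivity criterion for functionals of odd order. -/
lemma nonneg_of_odd {a b : ℝ} (hab : a < b) {j : ℕ} (ℓ : ℝ[X] →ₗ[ℝ] ℝ)
    (h0 : ∀ q : ℝ[X], q.natDegree ≤ j → 0 ≤ ℓ ((X - C a) * q ^ 2))
    (h1 : ∀ q : ℝ[X], q.natDegree ≤ j → 0 ≤ ℓ ((C b - X) * q ^ 2))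
    {p : ℝ[X]} (hd : p.natDegree ≤ 2 * j + 1) (hp : ∀ x ∈ Set.Ioo a b, 0 ≤ p.eval x) :
    0 ≤ ℓ p := by
  refine nonneg_of_nonneg_on_generators ℓ (fun q i k hi hk hq => ?_)
    (mem_intervalCone_of_nonneg hab hd hp)
  have hc : ∀ c : ℝ, ∀ x : ℝ[X], ℓ (C c * x) = c * ℓ x := fun c x => by
    rw [← smul_eq_C_mul, map_smul, smul_eq_mul]
  have hba : (0 : ℝ) < (b - a)⁻¹ := by rw [inv_pos]; linarith
  have hba' : C (b - a)⁻¹ * (C b - C a) = (1 : ℝ[X]) := by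
    rw [← C_sub, ← C_mul, inv_mul_cancel₀ (by linarith), C_1]
  interval_cases i <;> interval_cases k
  · rw [show q ^ 2 * (X - C a) ^ 0 * (C b - X) ^ 0 = C (b - a)⁻¹ * ((X - C a) * q ^ 2 +
      (C b - X) * q ^ 2) by linear_combination (-(q ^ 2)) * hba', hc, map_add]
    have := h0 q (by omega)
    have := h1 q (by omega)
    positivity
  · convert! h1 q (by omega) using 2
    ring
  · convert! h0 q (by omega) using 2
    ring
  · rw [show q ^ 2 * (X - C a) ^ 1 * (C b - X) ^ 1 = C (b - a)⁻¹ *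
      ((X - C a) * (q * (C b - X)) ^ 2 + (C b - X) * (q * (X - C a)) ^ 2) by
        linear_combination (-(q ^ 2 * (C b - X) * (X - C a))) * hba', hc, map_add]
    have h4 : (C b - X : ℝ[X]).natDegree ≤ 1 := by
      rw [← natDegree_neg, neg_sub]; exact natDegree_X_sub_C_le b
    have := h0 (q * (C b - X)) (by have := natDegree_mul_le (p := q) (q := C b - X); omega)
    have := h1 (q * (X - C a)) (by
      have := natDegree_mul_le (p := q) (q := X - C a)
      have := natDegree_X_sub_C_le a
      omega)
    positivity

/-! ### Representation of positive functionals -/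

/-- The moments of a probability measure on a compact interval. -/
noncomputable def momentMap (a b : ℝ) (N : ℕ) (μ : ProbabilityMeasure (Set.Icc a b)) : Fin N → ℝ :=
  fun i => ∫ x : Set.Icc a b, (x : ℝ) ^ ((i : ℕ) + 1) ∂(μ : Measure (Set.Icc a b))

lemma continuous_momentMap (a b : ℝ) (N : ℕ) : Continuous (momentMap a b N) := by
  refine continuous_pi fun i => ?_
  exact ProbabilityMeasure.continuous_integral_boundedContinuousFunction
    (BoundedContinuousFunction.mkOfCompact
      ⟨fun x : Set.Icc a b => (x : ℝ) ^ ((i : ℕ) + 1), by fun_prop⟩)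

lemma integrable_continuous_Icc {a b : ℝ} (μ : ProbabilityMeasure (Set.Icc a b))
    {f : Set.Icc a b → ℝ} (hf : Continuous f) : Integrable f (μ : Measure (Set.Icc a b)) :=
  (BoundedContinuousFunction.mkOfCompact ⟨f, hf⟩).integrable _

lemma convex_range_momentMap (a b : ℝ) (N : ℕ) : Convex ℝ (Set.range (momentMap a b N)) := by
  rintro _ ⟨μ, rfl⟩ _ ⟨ν, rfl⟩ s t hs ht hst
  have hp : IsProbabilityMeasure (ENNReal.ofReal s • (μ : Measure (Set.Icc a b)) +
      ENNReal.ofReal t • (ν : Measure (Set.Icc a b))) := by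
    constructor
    simp [← ENNReal.ofReal_add hs ht, hst]
  refine ⟨⟨_, hp⟩, ?_⟩
  ext i
  have hc : Continuous fun x : Set.Icc a b => (x : ℝ) ^ ((i : ℕ) + 1) := by fun_prop
  simp only [momentMap, ProbabilityMeasure.coe_mk, Pi.add_apply, Pi.smul_apply, smul_eq_mul]
  rw [integral_add_measure, integral_smul_measure, integral_smul_measure,
    ENNReal.toReal_ofReal hs, ENNReal.toReal_ofReal ht]
  · rfl
  · exact (integrable_continuous_Icc μ hc).smul_measure ENNReal.ofReal_ne_top
  · exact (integrable_continuous_Icc ν hc).smul_measure ENNReal.ofReal_ne_top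

lemma range_momentMap_subset (a b : ℝ) (N : ℕ) :
    Set.range (momentMap a b N) ⊆ momentSpace (Set.Icc a b) N := by
  rintro _ ⟨μ, rfl⟩
  have hm : Measurable (Subtype.val : Set.Icc a b → ℝ) := measurable_subtype_coe
  have hme : MeasurableEmbedding (Subtype.val : Set.Icc a b → ℝ) :=
    MeasurableEmbedding.subtype_coe measurableSet_Icc
  refine ⟨(μ : Measure (Set.Icc a b)).map Subtype.val, ⟨?_, ?_, fun k => ?_⟩, fun i => ?_⟩
  · exact Measure.isProbabilityMeasure_map hm.aemeasurable
  · rw [Measure.map_apply hm measurableSet_Icc.compl]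
    simp
  · rw [hme.integrable_map_iff]
    exact integrable_continuous_Icc μ (by fun_prop)
  · rw [hme.integral_map]; rfl

/-- The truncated Hausdorff moment problem. -/
lemma mem_momentSpace_Icc {a b : ℝ} {N : ℕ} (v : Fin N → ℝ)
    (h : ∀ p : ℝ[X], p.natDegree ≤ N → (∀ x ∈ Set.Icc a b, 0 ≤ p.eval x) → 0 ≤ momLin v p) :
    v ∈ momentSpace (Set.Icc a b) N := by
  by_contra hv
  have hv' : v ∉ Set.range (momentMap a b N) := fun h' => hv (range_momentMap_subset a b N h')
  -- Probability measures on a compact interval form a compact space, so a point outside the image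
  -- can be strictly separated from it. A separating functional `f < u` is the polynomial `u - ∑ c_i
  -- X^(i+1)`; Dirac measures show that it is nonnegative on the interval, yet it is negative at
  -- `v`.
  have hclosed : IsClosed (Set.range (momentMap a b N)) :=
    (isCompact_range (continuous_momentMap a b N)).isClosed
  obtain ⟨f, u, hf, hu⟩ := geometric_hahn_banach_closed_point (convex_range_momentMap a b N)
    hclosed hv'
  set c : Fin N → ℝ := fun i => f (Pi.single i 1) with hc
  have hfc : ∀ w : Fin N → ℝ, f w = ∑ i, c i * w i := fun w => by
    conv_lhs => rw [← Finset.univ_sum_single w]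
    rw [map_sum]
    refine Finset.sum_congr rfl fun i _ => ?_
    rw [hc, show (Pi.single i (w i) : Fin N → ℝ) = w i • Pi.single i 1 by
      rw [← Pi.single_smul]; simp, map_smul, smul_eq_mul, mul_comm]
  have key := h (C u * X ^ 0 - ∑ i : Fin N, C (c i) * X ^ ((i : ℕ) + 1)) ?_ ?_
  · simp only [map_sub, map_sum, momLin_C_mul, momLin_X_pow, mom_zero, mom_succ, ← hfc v] at key
    linarith
  · refine (natDegree_sub_le _ _).trans (max_le (by simp) ?_)
    exact natDegree_sum_le_of_forall_le _ _ fun i _ =>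
      (natDegree_C_mul_X_pow_le _ _).trans (by omega)
  · intro x hx
    have := hf (momentMap a b N (⟨Measure.dirac ⟨x, hx⟩, inferInstance⟩)) ⟨_, rfl⟩
    rw [hfc] at this
    simp only [momentMap, ProbabilityMeasure.coe_mk, integral_dirac] at this
    simp [eval_finsetSum]
    exact this.le

/-! ### Next moments -/

/-- The moment vector of length `k` that has `m_1, …, m_{k-1}` as its first entries, and last
entry `y`. -/
noncomputable def replaceMom {N : ℕ} (m : Fin N → ℝ) (k : ℕ) (y : ℝ) : Fin k → ℝ :=
  fun i => if (i : ℕ) + 1 = k then y else mom m ((i : ℕ) + 1)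

lemma mom_replaceMom_of_lt {N : ℕ} (m : Fin N → ℝ) {k : ℕ} (y : ℝ) {i : ℕ} (hi : i < k) :
    mom (replaceMom m k y) i = mom m i := by
  rcases i with _ | i
  · simp [mom]
  · have := mom_succ (replaceMom m k y) ⟨i, by omega⟩
    simp only at this
    rw [this]
    simp only [replaceMom, if_neg hi.ne]

lemma mom_replaceMom_self {N : ℕ} (m : Fin N → ℝ) {k : ℕ} (y : ℝ) (hk : 1 ≤ k) :
    mom (replaceMom m k y) k = y := by
  obtain ⟨k, rfl⟩ := Nat.exists_eq_add_of_le' hk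
  have := mom_succ (replaceMom m (k + 1) y) ⟨k, by omega⟩
  simp only at this
  rw [this]
  simp [replaceMom]

/-- The unknown moment enters only through the top coefficient, so each positivity condition becomes
a linear inequality in `y`. -/
lemma momLin_replaceMom {N : ℕ} (m : Fin N → ℝ) {k : ℕ} (y : ℝ) (hk : 1 ≤ k) {p : ℝ[X]}
    (hp : p.natDegree ≤ k) :
    momLin (replaceMom m k y) p = momLin m p + p.coeff k * (y - mom m k) := by
  rw [momLin_sub_momLin _ m hp fun i hi => mom_replaceMom_of_lt m y hi, mom_replaceMom_self m y hk]

lemma integral_eval_eq_momLin {N : ℕ} {v : Fin N → ℝ} {T : Set ℝ} {μ : Measure ℝ}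
    (hμ : IsProbOn T μ) {k : ℕ} (h : ∀ i ∈ Finset.Icc 1 k, ∫ x, x ^ i ∂μ = mom v i) {p : ℝ[X]}
    (hp : p.natDegree ≤ k) : ∫ x, p.eval x ∂μ = momLin v p := by
  have := hμ.isProb
  rw [momLin_eq_sum v hp]
  simp_rw [eval_eq_sum_range' (Nat.lt_succ_of_le hp)]
  rw [integral_finsetSum _ fun i _ => (hμ.integrable_pow i).const_mul _]
  refine Finset.sum_congr rfl fun i hi => ?_
  rw [integral_const_mul]
  rcases i with _ | i
  · simp [mom_zero]
  · rw [h _ (by simp at hi ⊢; omega)]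

lemma mem_nextMoments_iff {N : ℕ} (T : Set ℝ) (m : Fin N → ℝ) {k : ℕ} (hk : 1 ≤ k) (y : ℝ) :
    y ∈ nextMoments T m k ↔ replaceMom m k y ∈ momentSpace T k := by
  constructor
  · rintro ⟨μ, hμ, h1, h2⟩
    refine ⟨μ, hμ, fun i => ?_⟩
    unfold replaceMom
    split_ifs with hi
    · rw [hi, h2]
    · rw [h1 _ (by simp; omega)]
  · rintro ⟨μ, hμ, h⟩
    have h' : ∀ i ∈ Finset.Icc 1 k, ∫ x, x ^ i ∂μ = mom (replaceMom m k y) i := by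
      intro i hi
      obtain ⟨h1, h2⟩ := Finset.mem_Icc.1 hi
      obtain ⟨i, rfl⟩ := Nat.exists_eq_add_of_le' h1
      rw [h ⟨i, by omega⟩]
      exact (mom_succ _ ⟨i, by omega⟩).symm
    refine ⟨μ, hμ, fun i hi => ?_, ?_⟩
    · have := Finset.mem_Icc.1 hi
      rw [h' i (by simp; omega), mom_replaceMom_of_lt m y (by omega)]
    · rw [h' k (by simp [hk]), mom_replaceMom_self m y hk]

/-- Testing the `k`-th moments against nonnegative polynomials. -/
lemma nonneg_of_mem_nextMoments {N : ℕ} {T : Set ℝ} {m : Fin N → ℝ} {k : ℕ} (hk : 1 ≤ k) {y : ℝ}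
    (hy : y ∈ nextMoments T m k) {p : ℝ[X]} (hd : p.natDegree ≤ k)
    (hp : ∀ x ∈ T, 0 ≤ p.eval x) : 0 ≤ momLin m p + p.coeff k * (y - mom m k) := by
  rw [mem_nextMoments_iff T m hk] at hy
  obtain ⟨μ, hμ, h⟩ := hy
  rw [← momLin_replaceMom m y hk hd, ← integral_eval_eq_momLin hμ (fun i hi => ?_) hd]
  · refine integral_nonneg_of_ae ?_
    have : ∀ᵐ x ∂μ, x ∈ T := by rw [ae_iff]; exact hμ.supp
    filter_upwards [this] with x hx using hp x hx
  · obtain ⟨h1, h2⟩ := Finset.mem_Icc.1 hi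
    obtain ⟨i, rfl⟩ := Nat.exists_eq_add_of_le' h1
    rw [h ⟨i, by omega⟩]
    exact (mom_succ _ ⟨i, by omega⟩).symm

lemma mem_nextMoments_Icc {N : ℕ} {a b : ℝ} {m : Fin N → ℝ} {k : ℕ} (hk : 1 ≤ k)
    {y : ℝ} (h : ∀ p : ℝ[X], p.natDegree ≤ k → (∀ x ∈ Set.Ioo a b, 0 ≤ p.eval x) →
      0 ≤ momLin (replaceMom m k y) p) : y ∈ nextMoments (Set.Icc a b) m k := by
  rw [mem_nextMoments_iff _ m hk]
  exact mem_momentSpace_Icc _ fun p hd hp =>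
    h p hd fun x hx => hp x (Set.Ioo_subset_Icc_self hx)

lemma coeff_sq_of_natDegree_le {q : ℝ[X]} {e : ℕ} (hq : q.natDegree ≤ e) :
    (q ^ 2).coeff (2 * e) = q.coeff e ^ 2 := by
  rw [two_mul, sq, coeff_mul_add_eq_of_natDegree_le hq hq, sq]

/-- Sufficient condition for `y` to be a possible moment of odd order. -/
lemma mem_nextMoments_odd {N : ℕ} {s : ℝ} (hs : 0 < s) {m : Fin N → ℝ} {e : ℕ} {y : ℝ}
    (h0 : ∀ q : ℝ[X], q.natDegree ≤ e →
      0 ≤ momLin m ((C s + X) * q ^ 2) + q.coeff e ^ 2 * (y - mom m (2 * e + 1)))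
    (h1 : ∀ q : ℝ[X], q.natDegree ≤ e →
      0 ≤ momLin m ((C s - X) * q ^ 2) - q.coeff e ^ 2 * (y - mom m (2 * e + 1))) :
    y ∈ nextMoments (Set.Icc (-s) s) m (2 * e + 1) := by
  refine mem_nextMoments_Icc (by omega) fun p hd hp =>
    nonneg_of_odd (a := -s) (b := s) (by linarith) _ (fun q hq => ?_) (fun q hq => ?_) hd hp
  · have hc := coeff_mul_add_eq_of_natDegree_le (f := X - C (-s)) (g := q ^ 2) (df := 1) (dg := 2 * e)
      (natDegree_X_sub_C_le _) (natDegree_pow_le_of_le 2 hq)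
    rw [coeff_sq_of_natDegree_le hq, coeff_sub, coeff_X_one, coeff_C_succ, sub_zero, one_mul,
      add_comm] at hc
    rw [momLin_replaceMom m y (by omega), hc]
    · convert! h0 q hq using 4
      simp; ring
    · refine natDegree_mul_le.trans ?_
      have := natDegree_X_sub_C_le (-s)
      have := natDegree_pow_le_of_le 2 hq
      omega
  · have h4 : (C s - X : ℝ[X]).natDegree ≤ 1 := by
      rw [← natDegree_neg, neg_sub]; exact natDegree_X_sub_C_le s
    have hc := coeff_mul_add_eq_of_natDegree_le (f := C s - X) (g := q ^ 2) (df := 1) (dg := 2 * e)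
      h4 (natDegree_pow_le_of_le 2 hq)
    rw [coeff_sq_of_natDegree_le hq, coeff_sub, coeff_X_one, coeff_C_succ, zero_sub, neg_one_mul,
      add_comm] at hc
    rw [momLin_replaceMom m y (by omega), hc]
    · convert! h1 q hq using 1
      ring
    · refine natDegree_mul_le.trans ?_
      have := natDegree_pow_le_of_le 2 hq
      omega

/-- Sufficient condition for `y` to be a possible moment of even order. -/
lemma mem_nextMoments_even {N : ℕ} {s : ℝ} (hs : 0 < s) {m : Fin N → ℝ} {e : ℕ} {y : ℝ}
    (h0 : ∀ q : ℝ[X], q.natDegree ≤ e + 1 →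
      0 ≤ momLin m (q ^ 2) + q.coeff (e + 1) ^ 2 * (y - mom m (2 * (e + 1))))
    (h1 : ∀ q : ℝ[X], q.natDegree ≤ e →
      0 ≤ momLin m ((C (s ^ 2) - X ^ 2) * q ^ 2) - q.coeff e ^ 2 * (y - mom m (2 * (e + 1)))) :
    y ∈ nextMoments (Set.Icc (-s) s) m (2 * (e + 1)) := by
  refine mem_nextMoments_Icc (by omega) fun p hd hp =>
    nonneg_of_even (a := -s) (b := s) (by linarith) _ (fun q hq => ?_) (fun q hq => ?_) hd hp
  · rw [momLin_replaceMom m y (by omega) (natDegree_pow_le_of_le 2 hq),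
      coeff_sq_of_natDegree_le hq]
    exact h0 q hq
  · have hq : q.natDegree ≤ e := by omega
    have e1 : ((X - C (-s)) * (C s - X) : ℝ[X]) = C (s ^ 2) - X ^ 2 := by
      simp; ring
    have h4 : (C (s ^ 2) - X ^ 2 : ℝ[X]).natDegree ≤ 2 := by
      rw [← natDegree_neg, neg_sub, natDegree_sub_C]; simp
    have hc := coeff_mul_add_eq_of_natDegree_le (f := C (s ^ 2) - X ^ 2) (g := q ^ 2) (df := 2) (dg := 2 * e)
      h4 (natDegree_pow_le_of_le 2 hq)
    rw [coeff_sq_of_natDegree_le hq, coeff_sub, coeff_X_pow_self, coeff_C_succ, zero_sub,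
      neg_one_mul, show 2 + 2 * e = 2 * (e + 1) by ring] at hc
    rw [e1, momLin_replaceMom m y (by omega), hc]
    · convert! h1 q hq using 1
      ring
    · refine natDegree_mul_le.trans ?_
      have := natDegree_pow_le_of_le 2 hq
      omega

/-! ### Bounds for the extremal moments -/

lemma natDegree_le_of_degree_lt_succ {r : ℝ[X]} {k : ℕ} (hr : r.degree < (k + 1 : ℕ)) :
    r.natDegree ≤ k := natDegree_le_iff_degree_le.2 (by
  rw [degree_lt_iff_coeff_zero] at hr
  rw [degree_le_iff_coeff_zero]
  exact fun i hi => hr i (by exact_mod_cast hi))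

/-- A linear functional on a finite-dimensional inner product space is bounded; the constant is
built along the orthogonal basis `P_0, …, P_{k-1}`. -/
lemma exists_sq_le_mul_momLin_sq {N : ℕ} {m : Fin N → ℝ} {k : ℕ} (hm : PosUpTo m k)
    (ℓ : ℝ[X] →ₗ[ℝ] ℝ) :
    ∃ K, 0 ≤ K ∧ ∀ r : ℝ[X], r.degree < k → ℓ r ^ 2 ≤ K * momLin m (r ^ 2) := by
  induction k with
  | zero => exact ⟨0, le_rfl, fun r hr => by
      have : r = 0 := by simpa using hr
      simp [this]⟩
  | succ k ih =>
    have hm' := hm.mono (Nat.le_succ k)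
    obtain ⟨K, hK, h⟩ := ih hm'
    have hM := hm k (by omega)
    refine ⟨2 * ℓ (orthPoly m k) ^ 2 / orthNorm m k + 2 * K, by positivity, fun q hq => ?_⟩
    obtain ⟨r, hr, e⟩ := exists_eq_orthPoly_add hm' (natDegree_le_of_degree_lt_succ hq)
    set c := q.coeff k
    rw [e, momLin_sq_add hm' hr, map_add, ← smul_eq_C_mul, map_smul, smul_eq_mul]
    have h1 := h r hr
    have h2 := momLin_sq_nonneg hm' hr
    set R := momLin m (r ^ 2)
    set A := ℓ (orthPoly m k)
    set M := orthNorm m k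
    calc (c * A + ℓ r) ^ 2 ≤ 2 * A ^ 2 / M * (c ^ 2 * M) + 2 * (K * R) := by
          rw [show 2 * A ^ 2 / M * (c ^ 2 * M) = 2 * (c * A) ^ 2 by field_simp]
          nlinarith [sq_nonneg (c * A - ℓ r)]
      _ ≤ _ := by
          have : 0 ≤ 2 * A ^ 2 / M * R := by positivity
          have : 0 ≤ 2 * K * (c ^ 2 * M) := by positivity
          nlinarith

lemma exists_abs_momLin_mul_sq_le {N : ℕ} {m : Fin N → ℝ} {k : ℕ} (hm : PosUpTo m k) (w : ℝ[X]) :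
    ∃ K, 0 ≤ K ∧ ∀ r : ℝ[X], r.degree < k → |momLin m (w * r ^ 2)| ≤ K * momLin m (r ^ 2) := by
  induction k with
  | zero => exact ⟨0, le_rfl, fun r hr => by
      have : r = 0 := by simpa using hr
      simp [this]⟩
  | succ k ih =>
    have hm' := hm.mono (Nat.le_succ k)
    obtain ⟨K, hK, h⟩ := ih hm'
    obtain ⟨K', hK', h'⟩ := exists_sq_le_mul_momLin_sq hm'
      ((momLin m).comp (LinearMap.mulLeft ℝ (w * orthPoly m k)))
    simp only [LinearMap.comp_apply, LinearMap.mulLeft_apply] at h'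
    have hM := hm k (by omega)
    refine ⟨(|momLin m (w * orthPoly m k ^ 2)| + 1) / orthNorm m k + K + K', by positivity,
      fun q hq => ?_⟩
    obtain ⟨r, hr, e⟩ := exists_eq_orthPoly_add hm' (natDegree_le_of_degree_lt_succ hq)
    set c := q.coeff k
    rw [e, momLin_sq_add hm' hr, momLin_mul_sq_add]
    have h1 := h r hr
    have h1' := h' r hr
    have h2 := momLin_sq_nonneg hm' hr
    set R := momLin m (r ^ 2)
    set A := momLin m (w * orthPoly m k ^ 2)
    set B := momLin m (w * orthPoly m k * r)
    set D := momLin m (w * r ^ 2)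
    set M := orthNorm m k
    have e1 : |c ^ 2 * A + 2 * c * B + D| ≤ c ^ 2 * |A| + (c ^ 2 + B ^ 2) + |D| := by
      refine (abs_add_three _ _ _).trans ?_
      rw [abs_mul, abs_of_nonneg (sq_nonneg c)]
      have : |2 * c * B| ≤ c ^ 2 + B ^ 2 := by
        rw [abs_le]; constructor <;> nlinarith [sq_nonneg (c + B), sq_nonneg (c - B)]
      linarith
    refine e1.trans ?_
    have e2 : ((|A| + 1) / M + K + K') * (c ^ 2 * M + R) = (|A| + 1) * c ^ 2 + (K + K') * R +
        (((|A| + 1) / M) * R + (K + K') * (c ^ 2 * M)) := by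
      field_simp; ring
    have e3 : 0 ≤ ((|A| + 1) / M) * R + (K + K') * (c ^ 2 * M) := by positivity
    nlinarith

/-- For large `S` the monic minimiser of `∫ (S + w) q ^ 2` is close to the orthogonal polynomial. -/
lemma exists_lower_bound {N : ℕ} {m : Fin N → ℝ} {e : ℕ} (hm : PosUpTo m (e + 1)) (w : ℝ[X]) :
    ∃ K, 0 < K ∧ ∀ S, K < S → ∀ q : ℝ[X], q.natDegree ≤ e →
      q.coeff e ^ 2 * (S * orthNorm m e + momLin m (w * orthPoly m e ^ 2) - K / (S - K)) ≤
        momLin m ((C S + w) * q ^ 2) := by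
  have hm' := hm.mono (Nat.le_succ e)
  obtain ⟨K, hK, h⟩ := exists_sq_le_mul_momLin_sq hm'
    ((momLin m).comp (LinearMap.mulLeft ℝ (w * orthPoly m e)))
  simp only [LinearMap.comp_apply, LinearMap.mulLeft_apply] at h
  obtain ⟨K', hK', h'⟩ := exists_abs_momLin_mul_sq_le hm' w
  refine ⟨K + K' + 1, by positivity, fun S hS q hq => ?_⟩
  obtain ⟨r, hr, eq⟩ := exists_eq_orthPoly_add hm' hq
  set c := q.coeff e
  rw [add_mul, map_add, momLin_C_mul]
  nth_rewrite 1 2 [eq]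
  rw [momLin_sq_add hm' hr, momLin_mul_sq_add]
  have h1 := h r hr
  have h1' := neg_le_of_abs_le (h' r hr)
  have h2 := momLin_sq_nonneg hm' hr
  set R := momLin m (r ^ 2)
  set A := momLin m (w * orthPoly m e ^ 2)
  set B := momLin m (w * orthPoly m e * r)
  set D := momLin m (w * r ^ 2)
  set M := orthNorm m e
  set L := K + K' + 1 with hL
  have hL0 : 0 < L := by positivity
  have hT : 0 < S - L := by linarith
  -- The cross term is removed by completing the square, using `B² ≤ K R ≤ L R`. The remaining share
  -- `L R` of `S R` compensates `D ≥ -K' R`. The summand `1` in `L` only makes it positive.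
  have key : 0 ≤ c ^ 2 * (L / (S - L)) + 2 * c * B + (S - L) * R := by
    have e1 : c ^ 2 * (L / (S - L)) + 2 * c * B + (S - L) * R =
        ((c * L + B * (S - L)) ^ 2 + (S - L) ^ 2 * (L * R - B ^ 2)) / (L * (S - L)) := by
      field_simp; ring
    have : 0 ≤ L * R - B ^ 2 := by nlinarith
    rw [e1]; positivity
  nlinarith

lemma natDegree_mul_sq_le {w q : ℝ[X]} {d e : ℕ} (hw : w.natDegree ≤ d) (hq : q.natDegree ≤ e) :
    (w * q ^ 2).natDegree ≤ d + 2 * e :=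
  natDegree_mul_le.trans (add_le_add hw (natDegree_pow_le_of_le 2 hq))

lemma coeff_mul_sq {w q : ℝ[X]} {d e : ℕ} (hw : w.natDegree ≤ d) (hq : q.natDegree ≤ e) :
    (w * q ^ 2).coeff (d + 2 * e) = w.coeff d * q.coeff e ^ 2 := by
  rw [coeff_mul_add_eq_of_natDegree_le hw (natDegree_pow_le_of_le 2 hq),
    coeff_sq_of_natDegree_le hq]

/-- The weights `s ± X`, `1` and `s² - X²` yield the one-sided bounds on extremal moments; since
`P_e` is monic, `y` appears with the leading coefficient of `w`. -/
lemma test_of_mem_nextMoments {N : ℕ} {T : Set ℝ} {m : Fin N → ℝ} {d e : ℕ} (hde : 1 ≤ d + 2 * e)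
    {y : ℝ} (hy : y ∈ nextMoments T m (d + 2 * e)) (hm : PosUpTo m e) {w : ℝ[X]}
    (hw : w.natDegree ≤ d) (hp : ∀ x ∈ T, 0 ≤ w.eval x) :
    0 ≤ momLin m (w * orthPoly m e ^ 2) + w.coeff d * (y - mom m (d + 2 * e)) := by
  have := nonneg_of_mem_nextMoments hde hy
    (natDegree_mul_sq_le hw (natDegree_orthPoly_le m e)) (fun x hx => by
      rw [eval_mul, eval_pow]; exact mul_nonneg (hp x hx) (sq_nonneg _))
  rwa [coeff_mul_sq hw (natDegree_orthPoly_le m e), hm.coeff_orthPoly le_rfl, one_pow,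
    mul_one] at this

lemma sInf_sSup_mem_Icc {S : Set ℝ} {l l' u u' : ℝ} (h : S ⊆ Set.Icc l u') (hl : l' ∈ S)
    (hu : u ∈ S) : sInf S ∈ Set.Icc l l' ∧ sSup S ∈ Set.Icc u u' :=
  ⟨⟨le_csInf ⟨_, hl⟩ fun _ hx => (h hx).1, csInf_le ⟨l, fun _ hx => (h hx).1⟩ hl⟩,
    ⟨le_csSup ⟨u', fun _ hx => (h hx).2⟩ hu, csSup_le ⟨_, hl⟩ fun _ hx => (h hx).2⟩⟩

lemma div_sub_le_self {K s : ℝ} (hK : 0 < K) (hs : K + 1 ≤ s) : K / (s - K) ≤ K :=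
  div_le_self hK.le (by linarith)

lemma tendsto_const_div_sub (K : ℝ) : Tendsto (fun s : ℝ => K / (s - K)) atTop (𝓝 0) :=
  Tendsto.div_atTop tendsto_const_nhds (tendsto_atTop_add_const_right _ _ tendsto_id)

/-- For `y` equal to the given moment, the conditions hold once `s * orthNorm m e` dominates the
bounded terms. A strictly positive vector is thus realised by a measure on a large compact interval.
-/
lemma mem_nextMoments_odd_self_eventually {N : ℕ} {m : Fin N → ℝ} {e : ℕ}
    (hm : PosUpTo m (e + 1)) :
    ∀ᶠ s : ℝ in atTop, mom m (2 * e + 1) ∈ nextMoments (Set.Icc (-s) s) m (2 * e + 1) := by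
  obtain ⟨K₁, hK₁, h₁⟩ := exists_lower_bound hm X
  obtain ⟨K₂, hK₂, h₂⟩ := exists_lower_bound hm (-X)
  have hM := hm e (by omega)
  set M := orthNorm m e
  set A := momLin m (X * orthPoly m e ^ 2)
  rw [neg_mul, map_neg] at h₂
  filter_upwards [eventually_ge_atTop (K₁ + 1), eventually_ge_atTop (K₂ + 1),
    eventually_ge_atTop ((K₁ + K₂ + |A|) / M)] with s hs1 hs2 hs3
  rw [div_le_iff₀ hM] at hs3
  have := div_sub_le_self hK₁ hs1
  have := div_sub_le_self hK₂ hs2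
  have := neg_abs_le A
  have := le_abs_self A
  refine mem_nextMoments_odd (by linarith) (fun q hq => ?_) (fun q hq => ?_)
  · refine le_trans (le_trans ?_ (h₁ s (by linarith) q hq)) (by simp)
    exact mul_nonneg (sq_nonneg _) (by linarith)
  · refine le_trans (le_trans ?_ (h₂ s (by linarith) q hq)) (by simp [sub_eq_add_neg])
    exact mul_nonneg (sq_nonneg _) (by linarith)

/-- The test with `(s ± X) P_e²` bounds attainable moments, and `exists_lower_bound` with `w = ±X`
shows these bounds are sharp up to `K / (s - K)`. The coefficient `b_{e+1}` comes from `∫ x P_e²`.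
-/
lemma tendsto_extremal_odd {N : ℕ} {m : Fin N → ℝ} {e : ℕ} (hm : PosUpTo m (e + 1)) :
    Tendsto (fun s => lowerMom (-s) s m (2 * e + 1) -
      (mom m (2 * e + 1) - s * orthNorm m e - orthNorm m e * recB m (e + 1))) atTop (𝓝 0) ∧
    Tendsto (fun s => upperMom (-s) s m (2 * e + 1) -
      (mom m (2 * e + 1) + s * orthNorm m e - orthNorm m e * recB m (e + 1))) atTop (𝓝 0) := by
  obtain ⟨K₁, hK₁, h₁⟩ := exists_lower_bound hm X
  obtain ⟨K₂, hK₂, h₂⟩ := exists_lower_bound hm (-X)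
  have hM := hm e (by omega)
  rw [neg_mul, map_neg] at h₂
  rw [momLin_X_mul_orthPoly_sq hm] at h₁ h₂
  set M := orthNorm m e with hMdef
  set A := M * recB m (e + 1) with hA
  set y₀ := mom m (2 * e + 1) with hy₀
  have key : ∀ᶠ s : ℝ in atTop,
      lowerMom (-s) s m (2 * e + 1) ∈ Set.Icc (y₀ - s * M - A) (y₀ - s * M - A + K₁ / (s - K₁)) ∧
      upperMom (-s) s m (2 * e + 1) ∈ Set.Icc (y₀ + s * M - A - K₂ / (s - K₂)) (y₀ + s * M - A) := by
    filter_upwards [eventually_ge_atTop (K₁ + 1), eventually_ge_atTop (K₂ + 1),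
      eventually_ge_atTop ((K₁ + K₂) / M)] with s hs1 hs2 hs3
    rw [div_le_iff₀ hM] at hs3
    have b1 := div_sub_le_self hK₁ hs1
    have b2 := div_sub_le_self hK₂ hs2
    have b1' : 0 ≤ K₁ / (s - K₁) := div_nonneg hK₁.le (by linarith)
    have b2' : 0 ≤ K₂ / (s - K₂) := div_nonneg hK₂.le (by linarith)
    have hs : 0 < s := by linarith
    have hmem : ∀ y : ℝ, y₀ - s * M - A + K₁ / (s - K₁) ≤ y → y ≤ y₀ + s * M - A - K₂ / (s - K₂) →
        y ∈ nextMoments (Set.Icc (-s) s) m (2 * e + 1) := by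
      intro y hy1 hy2
      refine mem_nextMoments_odd hs (fun q hq => ?_) (fun q hq => ?_)
      · have := h₁ s (by linarith) q hq
        nlinarith [sq_nonneg (q.coeff e)]
      · have := h₂ s (by linarith) q hq
        rw [← sub_eq_add_neg (C s)] at this
        nlinarith [sq_nonneg (q.coeff e)]
    have hsq := momLin_orthPoly_sq (hm.mono (Nat.le_succ e))
    have hXsq := momLin_X_mul_orthPoly_sq hm
    refine sInf_sSup_mem_Icc (fun y hy => ⟨?_, ?_⟩) (hmem _ le_rfl (by linarith))
      (hmem _ (by linarith) le_rfl)
    · rw [add_comm] at hy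
      have := test_of_mem_nextMoments (by omega) hy (hm.mono (Nat.le_succ e)) (w := X + C s)
        (by rw [natDegree_X_add_C]) (fun x hx => by simp; linarith [hx.1])
      rw [add_mul, map_add, momLin_C_mul, hsq, hXsq, add_comm 1, ← hy₀] at this
      simp at this
      linarith
    · rw [add_comm] at hy
      have := test_of_mem_nextMoments (by omega) hy (hm.mono (Nat.le_succ e)) (w := C s - X)
        (by rw [← natDegree_neg, neg_sub]; exact natDegree_X_sub_C_le s)
        (fun x hx => by simp; linarith [hx.2])
      rw [sub_mul, map_sub, momLin_C_mul, hsq, hXsq, add_comm 1, ← hy₀] at this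
      simp at this
      linarith
  constructor
  · refine tendsto_of_tendsto_of_tendsto_of_le_of_le' tendsto_const_nhds
      (tendsto_const_div_sub K₁) ?_ ?_ <;> filter_upwards [key] with s hs
    · linarith [hs.1.1]
    · linarith [hs.1.2]
  · refine tendsto_of_tendsto_of_tendsto_of_le_of_le'
      (by simpa using (tendsto_const_div_sub K₂).neg) tendsto_const_nhds ?_ ?_ <;>
      filter_upwards [key] with s hs
    · linarith [hs.2.1]
    · linarith [hs.2.2]

/-- The lower bound comes from weight `1`, which does not involve `s`, so it is attained exactly
once the condition with weight `s² - X²` is slack. The constant `A` is `-∫ x² P_e²`, read with the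
stored moments; only its independence of `s` matters. -/
lemma extremal_even {N : ℕ} {m : Fin N → ℝ} {e : ℕ} (hm : PosUpTo m (e + 1)) :
    (∀ᶠ s in atTop,
      lowerMom (-s) s m (2 * (e + 1)) = mom m (2 * (e + 1)) - orthNorm m (e + 1)) ∧
    ∃ A : ℝ, Tendsto (fun s => upperMom (-s) s m (2 * (e + 1)) -
      (mom m (2 * (e + 1)) + s ^ 2 * orthNorm m e + A)) atTop (𝓝 0) := by
  obtain ⟨K, hK, h⟩ := exists_lower_bound hm (-X ^ 2)
  have hM := hm e (by omega)
  set M := orthNorm m e with hMdef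
  set M' := orthNorm m (e + 1) with hMdef'
  set A := momLin m (-X ^ 2 * orthPoly m e ^ 2) with hA
  set y₀ := mom m (2 * (e + 1)) with hy₀
  have key : ∀ᶠ s : ℝ in atTop,
      lowerMom (-s) s m (2 * (e + 1)) ∈ Set.Icc (y₀ - M') (y₀ - M') ∧
      upperMom (-s) s m (2 * (e + 1)) ∈ Set.Icc (y₀ + s ^ 2 * M + A - K / (s ^ 2 - K))
        (y₀ + s ^ 2 * M + A) := by
    have hsq : Tendsto (fun s : ℝ => s ^ 2) atTop atTop := tendsto_pow_atTop two_ne_zero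
    filter_upwards [eventually_gt_atTop 0, hsq.eventually_ge_atTop (K + 1),
      hsq.eventually_ge_atTop ((K - A - M') / M)] with s hs hs1 hs3
    rw [div_le_iff₀ hM] at hs3
    have b1 := div_sub_le_self hK hs1
    have b1' : 0 ≤ K / (s ^ 2 - K) := div_nonneg hK.le (by linarith)
    have hmem : ∀ y : ℝ, y₀ - M' ≤ y → y ≤ y₀ + s ^ 2 * M + A - K / (s ^ 2 - K) →
        y ∈ nextMoments (Set.Icc (-s) s) m (2 * (e + 1)) := by
      intro y hy1 hy2
      refine mem_nextMoments_even hs (fun q hq => ?_) (fun q hq => ?_)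
      · have := coeff_sq_mul_orthNorm_le hm hq
        nlinarith [sq_nonneg (q.coeff (e + 1))]
      · have := h (s ^ 2) (by linarith) q hq
        rw [← sub_eq_add_neg] at this
        nlinarith [sq_nonneg (q.coeff e)]
    refine sInf_sSup_mem_Icc (fun y hy => ⟨?_, ?_⟩) (hmem _ le_rfl (by linarith))
      (hmem _ (by linarith) le_rfl)
    · rw [← zero_add (2 * (e + 1))] at hy
      have := test_of_mem_nextMoments (by omega) hy hm (w := 1) (by simp) (fun x hx => by simp)
      rw [one_mul, momLin_orthPoly_sq hm, zero_add, ← hy₀] at this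
      simp at this
      linarith
    · rw [show 2 * (e + 1) = 2 + 2 * e by ring] at hy
      have := test_of_mem_nextMoments (by omega) hy (hm.mono (Nat.le_succ e))
        (w := C (s ^ 2) + -X ^ 2)
        (by rw [← sub_eq_add_neg, ← natDegree_neg, neg_sub, natDegree_sub_C]; simp)
        (fun x hx => by simp; nlinarith [hx.1, hx.2])
      rw [add_mul, map_add, momLin_C_mul, momLin_orthPoly_sq (hm.mono (Nat.le_succ e)), ← hA,
        show 2 + 2 * e = 2 * (e + 1) by ring, ← hy₀, coeff_add, coeff_C_succ, coeff_neg,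
        coeff_X_pow_self] at this
      linarith
  refine ⟨by filter_upwards [key] with s hs using le_antisymm hs.1.2 hs.1.1, A, ?_⟩
  refine tendsto_of_tendsto_of_tendsto_of_le_of_le' (g := fun s => -(K / (s ^ 2 - K)))
      (by simpa using ((tendsto_const_div_sub K).comp (tendsto_pow_atTop two_ne_zero)).neg)
      tendsto_const_nhds ?_ ?_ <;>
    filter_upwards [key] with s hs
  · linarith [hs.2.1]
  · linarith [hs.2.2]

/-- If all moments are strictly between their bounds, then the vector is strictly positive. -/
lemma posUpTo_of_mem_Ioo {N : ℕ} {m : Fin N → ℝ} {n : ℕ} {a b : ℝ}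
    (h : ∀ k ∈ Finset.Icc 1 (2 * n - 1),
      lowerMom a b m k < mom m k ∧ mom m k < upperMom a b m k) : PosUpTo m n := by
  intro j
  induction j using Nat.strong_induction_on with
  | _ j ih =>
  intro hj
  rcases j with _ | e
  · rw [orthNorm_zero]; exact one_pos
  have hm : PosUpTo m (e + 1) := fun i hi => ih i hi (by omega)
  obtain ⟨h1, h2⟩ := h (2 * (e + 1)) (by simp; omega)
  -- If no such moment existed, both bounds would take the default value `0`, against the two strict
  -- inequalities.
  have hne : (nextMoments (Set.Icc a b) m (2 * (e + 1))).Nonempty := by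
    by_contra hne
    rw [Set.not_nonempty_iff_eq_empty] at hne
    simp only [lowerMom, upperMom, hne, Real.sInf_empty, Real.sSup_empty] at h1 h2
    linarith
  -- Testing an attainable `y < m_{2e+2}` with `P_{e+1}²` gives `m_{2e+2} - y ≤ orthNorm m (e + 1)`.
  obtain ⟨y, hy, hym⟩ := exists_lt_of_csInf_lt hne h1
  rw [← zero_add (2 * (e + 1))] at hy
  have := test_of_mem_nextMoments (by omega) hy hm (w := 1) (by simp) (fun x hx => by simp)
  rw [one_mul, momLin_orthPoly_sq hm, zero_add] at this
  simp at this
  linarith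

/-! ### Limits of the beta factors -/

lemma tendsto_one_sub_rpow {y v : ℝ → ℝ} {a δ : ℝ}
    (hy : Tendsto (fun s => s ^ 2 * y s) atTop (𝓝 a))
    (hv : Tendsto (fun s => v s / s ^ 2) atTop (𝓝 δ)) :
    Tendsto (fun s => (1 - y s) ^ v s) atTop (𝓝 (Real.exp (-(δ * a)))) := by
  -- The parameter is changed to `x = s²`, so that the standard limit of `(1 + t/x)^x` applies.
  have h1 : Tendsto (fun x : ℝ => x * -y √x) atTop (𝓝 (-a)) := by
    have := (hy.comp Real.tendsto_sqrt_atTop).neg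
    refine this.congr' ?_
    filter_upwards [eventually_ge_atTop 0] with x hx
    simp [Real.sq_sqrt hx]
  have hsq : Tendsto (fun s : ℝ => s ^ 2) atTop atTop := tendsto_pow_atTop two_ne_zero
  have h2 := ((Real.tendsto_one_add_rpow_exp_of_tendsto h1).comp hsq).rpow hv
    (Or.inl (Real.exp_pos _).ne')
  rw [← Real.exp_mul] at h2
  rw [show -(δ * a) = -a * δ by ring]
  have hy0 : Tendsto y atTop (𝓝 0) := by
    have := hy.div_atTop hsq
    refine this.congr' ?_
    filter_upwards [eventually_gt_atTop 0] with s hs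
    field_simp
  refine h2.congr' ?_
  filter_upwards [eventually_gt_atTop 0, hy0.eventually_lt_const one_pos] with s hs hys
  simp only [Function.comp, Real.sqrt_sq hs.le, ← sub_eq_add_neg]
  rw [← Real.rpow_mul (by linarith), mul_div_cancel₀ _ (by positivity)]

lemma tendsto_odd_factor {x u v : ℝ → ℝ} {β δ c : ℝ} (hx : Tendsto x atTop (𝓝 β))
    (hu : Tendsto (fun s => u s - δ * s ^ 2) atTop (𝓝 c))
    (hv : Tendsto (fun s => v s - δ * s ^ 2) atTop (𝓝 c)) :
    Tendsto (fun s => (1 + x s / s) ^ u s * (1 - x s / s) ^ v s) atTop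
      (𝓝 (Real.exp (-(δ * β ^ 2)))) := by
  have hsq : Tendsto (fun s : ℝ => s ^ 2) atTop atTop := tendsto_pow_atTop two_ne_zero
  have hxs : Tendsto (fun s => x s / s) atTop (𝓝 0) := hx.div_atTop tendsto_id
  -- The product is `(1 - x²/s²)^v (1 + x/s)^(u-v)`. The first-order terms cancel, and the second
  -- factor tends to `1` because `u - v` stays bounded.
  have h1 : Tendsto (fun s => (1 - (x s / s) ^ 2) ^ v s) atTop (𝓝 (Real.exp (-(δ * β ^ 2)))) := by
    refine tendsto_one_sub_rpow ?_ ?_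
    · refine (hx.pow 2).congr' ?_
      filter_upwards [eventually_gt_atTop 0] with s hs
      field_simp
    · have := (hv.div_atTop hsq).const_add δ
      rw [add_zero] at this
      refine this.congr' ?_
      filter_upwards [eventually_gt_atTop 0] with s hs
      field_simp; ring
  have h2 : Tendsto (fun s => (1 + x s / s) ^ (u s - v s)) atTop (𝓝 ((1 + 0) ^ (c - c))) := by
    refine (hxs.const_add 1).rpow ?_ (Or.inl (by norm_num))
    exact (hu.sub hv).congr fun s => by ring
  have h3 := h1.mul h2
  simp only [sub_self, Real.rpow_zero, mul_one] at h3
  refine h3.congr' ?_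
  filter_upwards [hxs.eventually_lt_const one_pos,
    hxs.eventually_const_lt (show (-1 : ℝ) < 0 by norm_num)] with s h1 h2
  have p1 : 0 < 1 + x s / s := by linarith
  have p2 : 0 < 1 - x s / s := by linarith
  rw [show 1 - (x s / s) ^ 2 = (1 + x s / s) * (1 - x s / s) by ring,
    Real.mul_rpow p1.le p2.le, Real.rpow_sub p1]
  field_simp

lemma tendsto_even_factor {p g d : ℝ → ℝ} {a γ δ : ℝ} (ha : 0 < a)
    (hp : Tendsto (fun s => s ^ 2 * p s) atTop (𝓝 a)) (hg : Tendsto g atTop (𝓝 γ))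
    (hd : Tendsto (fun s => d s / s ^ 2) atTop (𝓝 δ)) :
    Tendsto (fun s => (s ^ 2 * p s) ^ g s * (1 - p s) ^ d s) atTop
      (𝓝 (a ^ γ * Real.exp (-(δ * a)))) :=
  (hp.rpow hg (Or.inl ha.ne')).mul (tendsto_one_sub_rpow hp hd)

lemma even_integral_eq (g d : ℝ) {s : ℝ} (hs : 0 < s) :
    (s ^ 2) ^ (g + 1) * ∫ x in (0 : ℝ)..1, x ^ g * (1 - x) ^ d =
      ∫ t, (Set.Ioc 0 (s ^ 2)).indicator (fun t => t ^ g * (1 - t / s ^ 2) ^ d) t := by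
  have hs2 : (0 : ℝ) < s ^ 2 := by positivity
  have h := intervalIntegral.integral_comp_div (a := 0) (b := s ^ 2)
    (fun x : ℝ => x ^ g * (1 - x) ^ d) hs2.ne'
  rw [zero_div, div_self hs2.ne', smul_eq_mul] at h
  rw [Real.rpow_add_one hs2.ne', mul_assoc, ← h, integral_indicator measurableSet_Ioc,
    intervalIntegral.integral_of_le hs2.le, ← integral_const_mul]
  refine setIntegral_congr_fun measurableSet_Ioc fun t ht => ?_
  rw [Real.div_rpow ht.1.le hs2.le]
  have := (Real.rpow_pos_of_pos hs2 g).ne'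
  field_simp

lemma tendsto_even_integral {g d : ℝ → ℝ} {γ δ : ℝ} (hγ : -1 < γ) (hδ : 0 < δ)
    (hg : Tendsto g atTop (𝓝 γ)) (hd : Tendsto (fun s => d s / s ^ 2) atTop (𝓝 δ)) :
    Tendsto (fun s => (s ^ 2) ^ (g s + 1) * ∫ x in (0 : ℝ)..1, x ^ g s * (1 - x) ^ d s) atTop
      (𝓝 (Real.Gamma (γ + 1) / δ ^ (γ + 1))) := by
  have hint := Real.integral_rpow_mul_exp_neg_mul_Ioi (a := γ + 1) (r := δ) (by linarith) hδ
  rw [add_sub_cancel_right, one_div, Real.inv_rpow hδ.le, mul_comm, ← div_eq_mul_inv,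
    ← integral_indicator measurableSet_Ioi] at hint
  rw [← hint]
  -- Eventually `γ' < g s < γ + 1`, so `t ^ g s` is at most `t ^ γ' + t ^ (γ + 1)`, covering `t ≤ 1`
  -- and `t > 1`. Choosing `γ' > -1` keeps this integrable at `0`.
  obtain ⟨γ', h1, h2⟩ := exists_between hγ
  set bound : ℝ → ℝ := (Set.Ioi 0).indicator
    fun t => t ^ γ' * Real.exp (-(δ / 2) * t) + t ^ (γ + 1) * Real.exp (-(δ / 2) * t) with hb
  have hbi : Integrable bound := by
    rw [hb, integrable_indicator_iff measurableSet_Ioi]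
    have e1 := integrableOn_rpow_mul_exp_neg_mul_rpow (p := 1) (s := γ') (b := δ / 2) h1 one_pos
      (by linarith)
    have e2 := integrableOn_rpow_mul_exp_neg_mul_rpow (p := 1) (s := γ + 1) (b := δ / 2)
      (by linarith) one_pos (by linarith)
    simp only [Real.rpow_one] at e1 e2
    exact e1.add e2
  have hsq : Tendsto (fun s : ℝ => s ^ 2) atTop atTop := tendsto_pow_atTop two_ne_zero
  have key : Tendsto (fun s => ∫ t, (Set.Ioc 0 (s ^ 2)).indicator
      (fun t => t ^ g s * (1 - t / s ^ 2) ^ d s) t) atTop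
      (𝓝 (∫ t, (Set.Ioi 0).indicator (fun t => t ^ γ * Real.exp (-(δ * t))) t)) := by
    refine tendsto_integral_filter_of_dominated_convergence bound ?_ ?_ hbi ?_
    · refine Eventually.of_forall fun s => Measurable.aestronglyMeasurable ?_
      exact Measurable.indicator (by fun_prop) measurableSet_Ioc
    · filter_upwards [eventually_gt_atTop 0, hg.eventually_const_lt h2,
        hg.eventually_lt_const (show γ < γ + 1 by linarith),
        hd.eventually_const_lt (show δ / 2 < δ by linarith)] with s hs hg1 hg2 hd1
      refine Eventually.of_forall fun t => ?_
      by_cases ht : t ∈ Set.Ioc 0 (s ^ 2)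
      · have ht0 : t ∈ Set.Ioi (0 : ℝ) := ht.1
        have ht' : (0 : ℝ) < t := ht.1
        rw [hb, Set.indicator_of_mem ht, Set.indicator_of_mem ht0, Real.norm_eq_abs]
        have hs2 : (0 : ℝ) < s ^ 2 := by positivity
        have hq : 0 ≤ 1 - t / s ^ 2 := by
          rw [sub_nonneg, div_le_one hs2]; exact ht.2
        rw [abs_of_nonneg (mul_nonneg (Real.rpow_nonneg ht'.le _) (Real.rpow_nonneg hq _)),
          ← add_mul]
        have hd0 : 0 ≤ d s := by
          have : 0 < d s / s ^ 2 := by linarith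
          exact ((div_pos_iff_of_pos_right hs2).1 this).le
        refine mul_le_mul ?_ ?_ (Real.rpow_nonneg hq _) (by positivity)
        · rcases le_or_gt t 1 with h | h
          · have := Real.rpow_le_rpow_of_exponent_ge ht' h hg1.le
            have := Real.rpow_nonneg ht'.le (γ + 1)
            linarith
          · have := Real.rpow_le_rpow_of_exponent_le h.le hg2.le
            have := Real.rpow_nonneg ht'.le γ'
            linarith
        · calc (1 - t / s ^ 2) ^ d s ≤ (Real.exp (-(t / s ^ 2))) ^ d s :=
                Real.rpow_le_rpow hq (Real.one_sub_le_exp_neg _) hd0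
            _ = Real.exp (-(d s / s ^ 2) * t) := by
                rw [← Real.exp_mul]; congr 1; ring
            _ ≤ _ := Real.exp_le_exp.2 (by nlinarith)
      · rw [Set.indicator_of_notMem ht, norm_zero, hb]
        refine Set.indicator_nonneg (fun t ht => ?_) _
        have : (0 : ℝ) < t := ht
        positivity
    · refine Eventually.of_forall fun t => ?_
      by_cases ht : 0 < t
      · rw [Set.indicator_of_mem (show t ∈ Set.Ioi (0 : ℝ) from ht)]
        have := tendsto_even_factor (p := fun s => t / s ^ 2) ht (tendsto_const_nhds.congr' (by
          filter_upwards [eventually_gt_atTop 0] with s hs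
          field_simp)) hg hd
        refine this.congr' ?_
        filter_upwards [eventually_gt_atTop 0, hsq.eventually_ge_atTop t] with s hs hst
        rw [Set.indicator_of_mem (Set.mem_Ioc.2 ⟨ht, hst⟩), mul_div_cancel₀ _ (by positivity)]
      · rw [Set.indicator_of_notMem (show t ∉ Set.Ioi (0 : ℝ) from ht)]
        refine tendsto_const_nhds.congr fun s => ?_
        rw [Set.indicator_of_notMem (fun h => ht h.1)]
  refine key.congr' ?_
  filter_upwards [eventually_gt_atTop 0] with s hs
  rw [even_integral_eq _ _ hs]

/-- The substitution `x = 1/2 + t/(2s)`, matching the scale on which odd canonical moments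
fluctuate. -/
lemma odd_integral_eq (u v : ℝ) {s : ℝ} (hs : 0 < s) :
    2 * s * 2 ^ (u + v) * ∫ x in (0 : ℝ)..1, x ^ u * (1 - x) ^ v =
      ∫ t, (Set.Ioc (-s) s).indicator (fun t => (1 + t / s) ^ u * (1 - t / s) ^ v) t := by
  have h := intervalIntegral.integral_comp_add_div (a := -s) (b := s)
    (fun x : ℝ => x ^ u * (1 - x) ^ v) (c := 2 * s) (by positivity) (1 / 2)
  rw [show 1 / 2 + -s / (2 * s) = 0 by field_simp; norm_num,
    show 1 / 2 + s / (2 * s) = 1 by field_simp; norm_num, smul_eq_mul] at h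
  rw [show 2 * s * 2 ^ (u + v) * ∫ x in (0 : ℝ)..1, x ^ u * (1 - x) ^ v = 2 ^ (u + v) *
    (2 * s * ∫ x in (0 : ℝ)..1, x ^ u * (1 - x) ^ v) by ring, ← h,
    integral_indicator measurableSet_Ioc, intervalIntegral.integral_of_le (by linarith),
    ← integral_const_mul]
  refine setIntegral_congr_fun measurableSet_Ioc fun t ht => ?_
  have h1 : 0 ≤ 1 + t / s := by
    have : -1 ≤ t / s := by rw [le_div_iff₀ hs]; linarith [ht.1]
    linarith
  have h2 : 0 ≤ 1 - t / s := by
    have : t / s ≤ 1 := by rw [div_le_iff₀ hs]; linarith [ht.2]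
    linarith
  rw [show 1 / 2 + t / (2 * s) = (1 + t / s) / 2 by field_simp,
    show 1 - (1 + t / s) / 2 = (1 - t / s) / 2 by field_simp; ring,
    Real.div_rpow h1 (by norm_num), Real.div_rpow h2 (by norm_num), Real.rpow_add (by norm_num)]
  have e1 := (Real.rpow_pos_of_pos (show (0 : ℝ) < 2 by norm_num) u).ne'
  have e2 := (Real.rpow_pos_of_pos (show (0 : ℝ) < 2 by norm_num) v).ne'
  field_simp

lemma tendsto_odd_integral {u v : ℝ → ℝ} {δ c : ℝ} (hδ : 0 < δ)
    (hu : Tendsto (fun s => u s - δ * s ^ 2) atTop (𝓝 c))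
    (hv : Tendsto (fun s => v s - δ * s ^ 2) atTop (𝓝 c)) :
    Tendsto (fun s => 2 * s * 2 ^ (u s + v s) * ∫ x in (0 : ℝ)..1, x ^ u s * (1 - x) ^ v s) atTop
      (𝓝 √(Real.pi / δ)) := by
  have hsq : Tendsto (fun s : ℝ => s ^ 2) atTop atTop := tendsto_pow_atTop two_ne_zero
  rw [← integral_gaussian]
  have key : Tendsto (fun s => ∫ t, (Set.Ioc (-s) s).indicator
      (fun t => (1 + t / s) ^ u s * (1 - t / s) ^ v s) t) atTop
      (𝓝 (∫ t : ℝ, Real.exp (-δ * t ^ 2))) := by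
    have hbi : Integrable fun t : ℝ => 4 * Real.exp (-(δ / 2) * t ^ 2) :=
      (integrable_exp_neg_mul_sq (by linarith)).const_mul 4
    refine tendsto_integral_filter_of_dominated_convergence _ ?_ ?_ hbi ?_
    · refine Eventually.of_forall fun s => Measurable.aestronglyMeasurable ?_
      exact Measurable.indicator (by fun_prop) measurableSet_Ioc
    · have huv := hu.sub hv
      rw [sub_self] at huv
      filter_upwards [eventually_gt_atTop 0, huv.eventually_lt_const one_pos,
        huv.eventually_const_lt (show (-1 : ℝ) < 0 by norm_num),
        hu.eventually_const_lt (show c - 1 < c by linarith),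
        hv.eventually_const_lt (show c - 1 < c by linarith),
        hsq.eventually_ge_atTop (-(c - 1) / (δ / 2))] with s hs h1 h2 h3 h4 h5
      refine Eventually.of_forall fun t => ?_
      by_cases ht : t ∈ Set.Ioc (-s) s
      · rw [Set.indicator_of_mem ht]
        have p1 : 0 ≤ 1 + t / s := by
          have : -1 ≤ t / s := by rw [le_div_iff₀ hs]; linarith [ht.1]
          linarith
        have p2 : 0 ≤ 1 - t / s := by
          have : t / s ≤ 1 := by rw [div_le_iff₀ hs]; linarith [ht.2]
          linarith
        rw [Real.norm_of_nonneg (mul_nonneg (Real.rpow_nonneg p1 _) (Real.rpow_nonneg p2 _))]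
        -- Both exponents lie in `[w, w + 1]` and both bases in `[0, 2]`, so replacing each exponent
        -- by `w` costs a factor `2`; this is the `4` in the bound.
        set w := min (u s) (v s) with hw
        have hws : δ / 2 * s ^ 2 ≤ w := by
          rw [div_le_iff₀ (by positivity)] at h5
          rw [hw, le_min_iff]; constructor <;> linarith
        have hw0 : 0 ≤ w := le_trans (by positivity) hws
        have hle : ∀ {x a : ℝ}, 0 ≤ x → x ≤ 2 → w ≤ a → a ≤ w + 1 → x ^ a ≤ 2 * x ^ w := by
          intro x a hx hx2 ha1 ha2
          rcases hx.eq_or_lt with rfl | hx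
          · rcases hw0.eq_or_lt with h | h
            · rw [← h, Real.rpow_zero]
              have := Real.rpow_le_one (le_refl (0:ℝ)) zero_le_one (hw0.trans ha1)
              linarith
            · rw [Real.zero_rpow (by linarith), Real.zero_rpow h.ne']; norm_num
          · rw [show a = w + (a - w) by ring, Real.rpow_add hx, mul_comm]
            refine mul_le_mul_of_nonneg_right ?_ (Real.rpow_nonneg hx.le _)
            calc x ^ (a - w) ≤ 2 ^ (a - w) := Real.rpow_le_rpow hx.le hx2 (by linarith)
              _ ≤ 2 ^ (1 : ℝ) := Real.rpow_le_rpow_of_exponent_le (by norm_num) (by linarith)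
              _ = 2 := Real.rpow_one 2
        have ew1 : u s ≤ w + 1 := by
          rcases min_choice (u s) (v s) with h | h <;> rw [hw, h] <;> linarith
        have ew2 : v s ≤ w + 1 := by
          rcases min_choice (u s) (v s) with h | h <;> rw [hw, h] <;> linarith
        calc (1 + t / s) ^ u s * (1 - t / s) ^ v s
            ≤ (2 * (1 + t / s) ^ w) * (2 * (1 - t / s) ^ w) := by
              refine mul_le_mul (hle p1 (by linarith) (min_le_left _ _) ew1)
                (hle p2 (by linarith) (min_le_right _ _) ew2) (Real.rpow_nonneg p2 _) ?_
              have := Real.rpow_nonneg p1 w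
              positivity
          _ = 4 * (1 - t ^ 2 / s ^ 2) ^ w := by
              rw [show 1 - t ^ 2 / s ^ 2 = (1 + t / s) * (1 - t / s) by field_simp; ring,
                Real.mul_rpow p1 p2]
              ring
          _ ≤ 4 * (Real.exp (-(t ^ 2 / s ^ 2))) ^ w := by
              refine mul_le_mul_of_nonneg_left (Real.rpow_le_rpow ?_ (Real.one_sub_le_exp_neg _) hw0)
                (by norm_num)
              rw [show 1 - t ^ 2 / s ^ 2 = (1 + t / s) * (1 - t / s) by field_simp; ring]
              exact mul_nonneg p1 p2
          _ ≤ 4 * Real.exp (-(δ / 2) * t ^ 2) := by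
              rw [← Real.exp_mul]
              refine mul_le_mul_of_nonneg_left (Real.exp_le_exp.2 ?_) (by norm_num)
              have := mul_le_mul_of_nonneg_left hws (show 0 ≤ t ^ 2 / s ^ 2 by positivity)
              rw [show t ^ 2 / s ^ 2 * (δ / 2 * s ^ 2) = δ / 2 * t ^ 2 by field_simp] at this
              linarith
      · rw [Set.indicator_of_notMem ht, norm_zero]; positivity
    · refine Eventually.of_forall fun t => ?_
      have := tendsto_odd_factor (x := fun _ => t) tendsto_const_nhds hu hv
      rw [neg_mul]
      refine this.congr' ?_
      filter_upwards [eventually_gt_atTop |t|] with s hs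
      rw [Set.indicator_of_mem (Set.mem_Ioc.2 ⟨(abs_lt.1 hs).1, (abs_lt.1 hs).2.le⟩)]
  refine key.congr' ?_
  filter_upwards [eventually_gt_atTop 0] with s hs
  rw [odd_integral_eq _ _ hs]

/-! ### Canonical moments -/

/-- The canonical moment of order `k`. -/
noncomputable def canonicalMom (a b : ℝ) {N : ℕ} (m : Fin N → ℝ) (k : ℕ) : ℝ :=
  (mom m k - lowerMom a b m k) / (upperMom a b m k - lowerMom a b m k)

lemma one_sub_canonicalMom {a b : ℝ} {N : ℕ} {m : Fin N → ℝ} {k : ℕ}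
    (h : lowerMom a b m k < upperMom a b m k) :
    (upperMom a b m k - mom m k) / (upperMom a b m k - lowerMom a b m k) =
      1 - canonicalMom a b m k := by
  have : upperMom a b m k - lowerMom a b m k ≠ 0 := by linarith
  unfold canonicalMom
  field_simp
  ring

/-- The distance between the bounds is about `2 s M`, and their midpoint is `m_{2e+1} - M b_{e+1} +
o(1)`, where `M = orthNorm m e`. -/
lemma canonicalMom_odd {N : ℕ} {m : Fin N → ℝ} {e : ℕ} (hm : PosUpTo m (e + 1)) :
    (∀ᶠ s in atTop, lowerMom (-s) s m (2 * e + 1) < mom m (2 * e + 1) ∧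
      mom m (2 * e + 1) < upperMom (-s) s m (2 * e + 1)) ∧
    Tendsto (fun s => s * (2 * canonicalMom (-s) s m (2 * e + 1) - 1)) atTop
      (𝓝 (recB m (e + 1))) := by
  obtain ⟨h1, h2⟩ := tendsto_extremal_odd hm
  have hM := hm e (by omega)
  set M := orthNorm m e with hMdef
  set b := recB m (e + 1)
  set y := mom m (2 * e + 1)
  have hlin : Tendsto (fun s : ℝ => s * M) atTop atTop := tendsto_id.atTop_mul_const hM
  have hev : ∀ᶠ s in atTop, lowerMom (-s) s m (2 * e + 1) < y ∧
      y < upperMom (-s) s m (2 * e + 1) := by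
    filter_upwards [h1.eventually_lt_const one_pos,
      h2.eventually_const_lt (show (-1 : ℝ) < 0 by norm_num),
      hlin.eventually_gt_atTop (1 - M * b), hlin.eventually_gt_atTop (1 + M * b)] with s e1 e2 e3 e4
    constructor <;> linarith
  refine ⟨hev, ?_⟩
  have hden : Tendsto (fun s => (upperMom (-s) s m (2 * e + 1) - lowerMom (-s) s m (2 * e + 1)) / s)
      atTop (𝓝 (2 * M)) := by
    have := ((h2.sub h1).div_atTop tendsto_id).add_const (2 * M)
    rw [zero_add] at this
    refine this.congr' ?_
    filter_upwards [eventually_gt_atTop 0] with s hs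
    simp only [id]
    field_simp
    ring
  have hnum : Tendsto (fun s => 2 * y - lowerMom (-s) s m (2 * e + 1) - upperMom (-s) s m (2 * e + 1))
      atTop (𝓝 (2 * M * b)) := by
    have := (h1.add h2).const_sub (2 * M * b)
    rw [add_zero, sub_zero] at this
    refine this.congr fun s => by ring
  have := hnum.div hden (by positivity)
  rw [mul_div_cancel_left₀ _ (by positivity)] at this
  refine this.congr' ?_
  filter_upwards [hev, eventually_gt_atTop 0] with s hs hs0
  have : upperMom (-s) s m (2 * e + 1) - lowerMom (-s) s m (2 * e + 1) ≠ 0 := by linarith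
  simp only [Pi.div_apply, canonicalMom]
  field_simp
  ring

/-- The numerator is eventually `orthNorm m (e + 1)`, the denominator is about `s² * orthNorm m e`,
and the ratio of norms is `a_{e+1}`. -/
lemma canonicalMom_even {N : ℕ} {m : Fin N → ℝ} {e : ℕ} (hm : PosUpTo m (e + 2)) :
    (∀ᶠ s in atTop, lowerMom (-s) s m (2 * (e + 1)) < mom m (2 * (e + 1)) ∧
      mom m (2 * (e + 1)) < upperMom (-s) s m (2 * (e + 1))) ∧
    Tendsto (fun s => s ^ 2 * canonicalMom (-s) s m (2 * (e + 1))) atTop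
      (𝓝 (recA m (e + 1))) := by
  obtain ⟨h1, A, h2⟩ := extremal_even (hm.mono (Nat.le_succ (e + 1)))
  have hM := hm e (by omega)
  have hM' := hm (e + 1) (by omega)
  rw [recA_eq, Nat.add_sub_cancel]
  set M := orthNorm m e with hMdef
  set M' := orthNorm m (e + 1) with hMdef'
  set y := mom m (2 * (e + 1))
  have hsq : Tendsto (fun s : ℝ => s ^ 2) atTop atTop := tendsto_pow_atTop two_ne_zero
  have hlin : Tendsto (fun s : ℝ => s ^ 2 * M) atTop atTop := hsq.atTop_mul_const hM
  have hev : ∀ᶠ s in atTop, lowerMom (-s) s m (2 * (e + 1)) < y ∧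
      y < upperMom (-s) s m (2 * (e + 1)) := by
    filter_upwards [h1, h2.eventually_const_lt (show (-1 : ℝ) < 0 by norm_num),
      hlin.eventually_gt_atTop (1 - A)] with s e1 e2 e3
    constructor <;> linarith
  refine ⟨hev, ?_⟩
  have hden : Tendsto (fun s => (upperMom (-s) s m (2 * (e + 1)) - lowerMom (-s) s m (2 * (e + 1))) /
      s ^ 2) atTop (𝓝 M) := by
    have := ((h2.add_const (A + M')).div_atTop hsq).add_const M
    rw [zero_add] at this
    refine this.congr' ?_
    filter_upwards [eventually_gt_atTop 0, h1] with s hs h1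
    rw [h1]
    field_simp
    ring
  refine ((tendsto_const_nhds (x := M')).div hden hM.ne').congr' ?_
  filter_upwards [hev, eventually_gt_atTop 0, h1] with s hs hs0 h1
  have : upperMom (-s) s m (2 * (e + 1)) - lowerMom (-s) s m (2 * (e + 1)) ≠ 0 := by linarith
  simp only [Pi.div_apply, canonicalMom]
  rw [show y - lowerMom (-s) s m (2 * (e + 1)) = M' by rw [h1]; ring]
  field_simp

/-! ### The factors of the density -/

open Classical in
/-- The `k`-th factor of the density, without the normalising constant. -/
noncomputable def densityFactor (a b : ℝ) {N : ℕ} (m : Fin N → ℝ) (k : ℕ) (g d : ℝ) : ℝ :=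
  ((mom m k - lowerMom a b m k) / (upperMom a b m k - lowerMom a b m k)) ^ g *
    ((upperMom a b m k - mom m k) / (upperMom a b m k - lowerMom a b m k)) ^ d *
    if lowerMom a b m k < mom m k ∧ mom m k < upperMom a b m k then 1 else 0

lemma densityFactor_of_lt {a b : ℝ} {N : ℕ} {m : Fin N → ℝ} {k : ℕ} {g d : ℝ}
    (h : lowerMom a b m k < mom m k ∧ mom m k < upperMom a b m k) :
    densityFactor a b m k g d = canonicalMom a b m k ^ g * (1 - canonicalMom a b m k) ^ d := by
  rw [densityFactor, if_pos h, mul_one, one_sub_canonicalMom (h.1.trans h.2), canonicalMom]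

lemma canonicalMom_mem_Ioo {a b : ℝ} {N : ℕ} {m : Fin N → ℝ} {k : ℕ}
    (h : lowerMom a b m k < mom m k ∧ mom m k < upperMom a b m k) :
    0 < canonicalMom a b m k ∧ canonicalMom a b m k < 1 := by
  unfold canonicalMom
  constructor
  · exact div_pos (by linarith) (by linarith)
  · rw [div_lt_one (by linarith)]; linarith

/-- Here `c` stands for `N - k`. Density factor and integral both need rescaling by `2^(g+d)`, which
cancels; the extra exponent `2c` and the substitution leave `2s * 2^(2c)`. -/
lemma tendsto_densityFactor_odd {N : ℕ} {m : Fin N → ℝ} {e : ℕ} (hm : PosUpTo m (e + 1)) (c : ℝ)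
    {g d : ℝ → ℝ} {δ : ℝ} (hδ : 0 < δ)
    (hg : Tendsto (fun s => g s - δ * s ^ 2) atTop (𝓝 0))
    (hd : Tendsto (fun s => d s - δ * s ^ 2) atTop (𝓝 0)) :
    Tendsto (fun s => densityFactor (-s) s m (2 * e + 1) (g s) (d s) *
      (∫ x in (0 : ℝ)..1, x ^ (c + g s) * (1 - x) ^ (c + d s))⁻¹ * (2 * s * 2 ^ (2 * c))⁻¹) atTop
      (𝓝 (√(δ / Real.pi) * Real.exp (-(δ * recB m (e + 1) ^ 2)))) := by
  obtain ⟨hev, hp⟩ := canonicalMom_odd hm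
  have hF := tendsto_odd_factor hp hg hd
  have hc : ∀ {f : ℝ → ℝ}, Tendsto (fun s => f s - δ * s ^ 2) atTop (𝓝 0) →
      Tendsto (fun s => (c + f s) - δ * s ^ 2) atTop (𝓝 c) := fun h => by
    have := h.const_add c
    rw [add_zero] at this
    exact this.congr fun s => by ring
  have hJ := tendsto_odd_integral hδ (hc hg) (hc hd)
  have hpi : (0 : ℝ) < √(Real.pi / δ) := Real.sqrt_pos.2 (div_pos Real.pi_pos hδ)
  have h := hF.mul (hJ.inv₀ hpi.ne')
  rw [← Real.sqrt_inv, inv_div, mul_comm (Real.exp _)] at h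
  refine h.congr' ?_
  filter_upwards [hev, eventually_gt_atTop 0] with s hs hs0
  rw [densityFactor_of_lt hs]
  obtain ⟨p0, p1⟩ := canonicalMom_mem_Ioo hs
  set p := canonicalMom (-s) s m (2 * e + 1)
  rw [show 1 + s * (2 * p - 1) / s = 2 * p by field_simp; ring,
    show 1 - s * (2 * p - 1) / s = 2 * (1 - p) by field_simp; ring,
    Real.mul_rpow (by norm_num) p0.le, Real.mul_rpow (by norm_num) (by linarith),
    show c + g s + (c + d s) = 2 * c + g s + d s by ring, Real.rpow_add (by norm_num),
    Real.rpow_add (by norm_num)]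
  have e1 := (Real.rpow_pos_of_pos (show (0 : ℝ) < 2 by norm_num) (g s)).ne'
  have e2 := (Real.rpow_pos_of_pos (show (0 : ℝ) < 2 by norm_num) (d s)).ne'
  have e3 := (Real.rpow_pos_of_pos (show (0 : ℝ) < 2 by norm_num) (2 * c)).ne'
  simp only [mul_inv]
  field_simp

lemma tendsto_densityFactor_even {N : ℕ} {m : Fin N → ℝ} {e : ℕ} (hm : PosUpTo m (e + 2)) {c : ℝ}
    {g d : ℝ → ℝ} {γ δ : ℝ} (hγ : -1 < c + γ) (hδ : 0 < δ)
    (hg : Tendsto g atTop (𝓝 γ)) (hd : Tendsto (fun s => d s / s ^ 2) atTop (𝓝 δ)) :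
    Tendsto (fun s => densityFactor (-s) s m (2 * (e + 1)) (g s) (d s) *
      (∫ x in (0 : ℝ)..1, x ^ (c + g s) * (1 - x) ^ (c + d s))⁻¹ * ((s ^ 2) ^ (c + 1))⁻¹) atTop
      (𝓝 (δ ^ (c + γ + 1) / Real.Gamma (c + γ + 1) * recA m (e + 1) ^ γ *
        Real.exp (-(δ * recA m (e + 1))))) := by
  obtain ⟨hev, hp⟩ := canonicalMom_even hm
  have ha : 0 < recA m (e + 1) := div_pos (hm _ (by omega)) (hm _ (by omega))
  have hsq : Tendsto (fun s : ℝ => s ^ 2) atTop atTop := tendsto_pow_atTop two_ne_zero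
  have hF := tendsto_even_factor ha hp hg hd
  have hd' : Tendsto (fun s => (c + d s) / s ^ 2) atTop (𝓝 δ) := by
    have := (tendsto_const_nhds (x := c).div_atTop hsq).add hd
    rw [zero_add] at this
    exact this.congr fun s => by ring
  have hJ := tendsto_even_integral hγ hδ (hg.const_add c) hd'
  have hG : 0 < Real.Gamma (c + γ + 1) := Real.Gamma_pos_of_pos (by linarith)
  have hD : 0 < δ ^ (c + γ + 1) := Real.rpow_pos_of_pos hδ _
  have h := hF.mul (hJ.inv₀ (div_pos hG hD).ne')
  rw [inv_div, mul_comm (recA m (e + 1) ^ γ * _) (_ / _), ← mul_assoc] at h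
  refine h.congr' ?_
  filter_upwards [hev, eventually_gt_atTop 0] with s hs hs0
  rw [densityFactor_of_lt hs]
  obtain ⟨p0, p1⟩ := canonicalMom_mem_Ioo hs
  set p := canonicalMom (-s) s m (2 * (e + 1))
  have hs2 : (0 : ℝ) < s ^ 2 := by positivity
  rw [Real.mul_rpow hs2.le p0.le, show c + g s + 1 = g s + (c + 1) by ring,
    Real.rpow_add hs2]
  have e1 := (Real.rpow_pos_of_pos hs2 (g s)).ne'
  simp only [mul_inv]
  field_simp

/-! ### Pointwise convergence -/

lemma prod_Icc_odd_even {n : ℕ} (hn : 1 ≤ n) (f : ℕ → ℝ) :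
    ∏ k ∈ Finset.Icc 1 (2 * n - 1), f k =
      (∏ k ∈ Finset.Icc 1 n, f (2 * k - 1)) * ∏ k ∈ Finset.Icc 1 (n - 1), f (2 * k) := by
  induction n, hn using Nat.le_induction with
  | base => simp
  | succ n hn ih =>
    rw [show 2 * (n + 1) - 1 = 2 * n - 1 + 1 + 1 by omega, Finset.prod_Icc_succ_top (by omega),
      Finset.prod_Icc_succ_top (by omega), ih, Finset.prod_Icc_succ_top (by omega),
      show n + 1 - 1 = n - 1 + 1 by omega, Finset.prod_Icc_succ_top (by omega : 1 ≤ n - 1 + 1),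
      show 2 * n - 1 + 1 = 2 * n by omega, show n - 1 + 1 = n by omega,
      show 2 * (n + 1) - 1 = 2 * n + 1 by omega]
    ring

/-- The offset `c` makes the induction close, since raising `n` shifts every summand; adding `n` on
the left avoids natural subtraction. -/
lemma sum_scale_exponents (n c : ℕ) :
    ∑ k ∈ Finset.Icc 1 n, (1 + 4 * (n + c - k)) + n = 2 * n * n + 4 * n * c := by
  induction n generalizing c with
  | zero => simp
  | succ n ih =>
    have := ih (c + 1)
    rw [Finset.sum_Icc_succ_top (by omega), show n + 1 + c - (n + 1) = c by omega,
      Finset.sum_congr rfl fun k _ => by rw [show n + 1 + c - k = n + (c + 1) - k by omega]]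
    linarith

lemma scale_prod {n : ℕ} (hn : 1 ≤ n) (s : ℝ) :
    (∏ k ∈ Finset.Icc 1 n, (2 * s * 2 ^ (4 * (n - k)))) *
      ∏ k ∈ Finset.Icc 1 (n - 1), s ^ (4 * (n - k)) =
      (2 * s) ^ ((2 * n - 1) * (2 * n - 1 + 1) / 2) := by
  have h1 : ∏ k ∈ Finset.Icc 1 (n - 1), s ^ (4 * (n - k)) =
      ∏ k ∈ Finset.Icc 1 n, s ^ (4 * (n - k)) := by
    obtain ⟨n, rfl⟩ := Nat.exists_eq_add_of_le' hn
    rw [Nat.add_sub_cancel, Finset.prod_Icc_succ_top (by omega)]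
    simp
  rw [h1, ← Finset.prod_mul_distrib, Finset.prod_congr rfl fun k _ =>
    show 2 * s * 2 ^ (4 * (n - k)) * s ^ (4 * (n - k)) = (2 * s) ^ (1 + 4 * (n - k)) by
      rw [mul_pow, pow_add, pow_add, pow_one, pow_one]; ring, Finset.prod_pow_eq_pow_sum]
  congr 1
  have h2 := sum_scale_exponents n 0
  obtain ⟨n, rfl⟩ := Nat.exists_eq_add_of_le' hn
  rw [show 2 * (n + 1) - 1 = 2 * n + 1 by omega,
    show (2 * n + 1) * (2 * n + 1 + 1) = 2 * ((2 * n + 1) * (n + 1)) by ring,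
    Nat.mul_div_cancel_left _ (by norm_num)]
  simp only [add_zero] at h2
  nlinarith

/-- The power of `b - a` is distributed so that each factor has its own limit. The shares are `2s *
2^(2c)` with `c = 2(n-k)` for odd order and `(s²)^(c+1)` with `c = 2(n-k) - 1` for even order. -/
lemma momentDensity_eq {n : ℕ} (hn : 1 ≤ n) (s : ℝ) (γ δ : ℕ → ℝ) (m : Fin (2 * n - 1) → ℝ) :
    momentDensity (-s) s (2 * n - 1) γ δ m =
      (∏ k ∈ Finset.Icc 1 n, (densityFactor (-s) s m (2 * k - 1) (γ (2 * k - 1)) (δ (2 * k - 1)) *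
        (∫ x in (0 : ℝ)..1, x ^ (((2 * n - 1 : ℕ) : ℝ) - (2 * k - 1 : ℕ) + γ (2 * k - 1)) *
          (1 - x) ^ (((2 * n - 1 : ℕ) : ℝ) - (2 * k - 1 : ℕ) + δ (2 * k - 1)))⁻¹ *
          (2 * s * 2 ^ (4 * (n - k)))⁻¹)) *
      ∏ k ∈ Finset.Icc 1 (n - 1), (densityFactor (-s) s m (2 * k) (γ (2 * k)) (δ (2 * k)) *
        (∫ x in (0 : ℝ)..1, x ^ (((2 * n - 1 : ℕ) : ℝ) - (2 * k : ℕ) + γ (2 * k)) *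
          (1 - x) ^ (((2 * n - 1 : ℕ) : ℝ) - (2 * k : ℕ) + δ (2 * k)))⁻¹ *
          (s ^ (4 * (n - k)))⁻¹) := by
  simp only [Finset.prod_mul_distrib, Finset.prod_inv_distrib]
  have h1 := prod_Icc_odd_even hn fun k => densityFactor (-s) s m k (γ k) (δ k)
  have h2 := prod_Icc_odd_even hn fun k => ∫ x in (0 : ℝ)..1,
    x ^ (((2 * n - 1 : ℕ) : ℝ) - k + γ k) * (1 - x) ^ (((2 * n - 1 : ℕ) : ℝ) - k + δ k)
  have h3 := scale_prod hn s
  simp only [Finset.prod_mul_distrib] at h3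
  unfold momentDensity normConst
  simp only [densityFactor] at h1 ⊢
  rw [h1, h2, show s - -s = 2 * s by ring, ← h3]
  simp only [mul_inv]
  ring

lemma momentDensity_eq_zero {n : ℕ} (a b : ℝ) (γ δ : ℕ → ℝ) {m : Fin (2 * n - 1) → ℝ}
    (hm : ¬ PosUpTo m n) : momentDensity a b (2 * n - 1) γ δ m = 0 := by
  have : ¬ ∀ k ∈ Finset.Icc 1 (2 * n - 1),
      lowerMom a b m k < mom m k ∧ mom m k < upperMom a b m k := fun h => hm (posUpTo_of_mem_Ioo h)
  push Not at this
  obtain ⟨k, hk, h⟩ := this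
  unfold momentDensity
  rw [Finset.prod_eq_zero hk, mul_zero]
  rw [if_neg, mul_zero]
  rintro ⟨h1, h2⟩
  exact absurd h2 (h h1).not_gt

lemma limitDensity_eq_zero {n : ℕ} (γ δ : ℕ → ℝ) {m : Fin (2 * n - 1) → ℝ}
    (hm : ¬ PosUpTo m n) : limitDensity n γ δ m = 0 := by
  rw [posUpTo_iff_recA_pos] at hm
  push Not at hm
  obtain ⟨k, hk, h⟩ := hm
  unfold limitDensity
  rw [Finset.prod_eq_zero hk, mul_zero]
  rw [if_neg h.not_gt, mul_zero]

lemma tendsto_momentDensity {n : ℕ} (hn : 1 ≤ n) {γ δ : ℕ → ℝ}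
    (hγ : ∀ k ∈ Finset.Icc 1 (n - 1), -1 < γ k)
    (hδ : ∀ k ∈ Finset.Icc 1 (2 * n - 1), 0 < δ k)
    {γs δs : ℝ → ℕ → ℝ}
    (hγodd : ∀ k ∈ Finset.Icc 1 n,
      (fun s => γs s (2 * k - 1) - δ (2 * k - 1) * s ^ 2) =o[atTop] (fun _ => (1 : ℝ)))
    (hδodd : ∀ k ∈ Finset.Icc 1 n,
      (fun s => δs s (2 * k - 1) - δ (2 * k - 1) * s ^ 2) =o[atTop] (fun _ => (1 : ℝ)))
    (hγeven : ∀ k ∈ Finset.Icc 1 (n - 1),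
      (fun s => γs s (2 * k) - γ k) =o[atTop] (fun _ => (1 : ℝ)))
    (hδeven : ∀ k ∈ Finset.Icc 1 (n - 1),
      (fun s => δs s (2 * k) - δ (2 * k) * s ^ 2) =o[atTop] (fun s => s ^ 2))
    (m : Fin (2 * n - 1) → ℝ) :
    Tendsto (fun s : ℝ => momentDensity (-s) s (2 * n - 1) (γs s) (δs s) m) atTop
        (𝓝 (limitDensity n γ δ m)) := by
  by_cases hm : PosUpTo m n
  swap
  · rw [limitDensity_eq_zero γ δ hm]
    exact tendsto_const_nhds.congr fun s => (momentDensity_eq_zero _ _ _ _ hm).symm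
  simp_rw [momentDensity_eq hn]
  unfold limitDensity
  refine (tendsto_finsetProd _ fun k hk => ?_).mul (tendsto_finsetProd _ fun k hk => ?_)
  · have h1 := (isLittleO_one_iff ℝ).1 (hγodd k hk)
    have h2 := (isLittleO_one_iff ℝ).1 (hδodd k hk)
    obtain ⟨hk1, hk2⟩ := Finset.mem_Icc.1 hk
    have hδk := hδ (2 * k - 1) (by simp; omega)
    obtain ⟨e, rfl⟩ := Nat.exists_eq_add_of_le' hk1
    have := tendsto_densityFactor_odd (hm.mono hk2)
      (((2 * n - 1 : ℕ) : ℝ) - (2 * (e + 1) - 1 : ℕ)) hδk h1 h2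
    rw [show 2 * e + 1 = 2 * (e + 1) - 1 by omega] at this
    refine this.congr fun s => ?_
    rw [← Real.rpow_natCast 2 (4 * (n - (e + 1)))]
    congr 4
    rw [← Nat.cast_sub (by omega)]
    norm_cast
    omega
  · have h1 := (isLittleO_one_iff ℝ).1 (hγeven k hk)
    have h2 := (hδeven k hk).tendsto_div_nhds_zero
    obtain ⟨hk1, hk2⟩ := Finset.mem_Icc.1 hk
    have hδk := hδ (2 * k) (by simp; omega)
    have hγk := hγ k hk
    obtain ⟨e, rfl⟩ := Nat.exists_eq_add_of_le' hk1
    have hc : (((2 * n - 1 : ℕ) : ℝ) - (2 * (e + 1) : ℕ)) = 2 * n - 2 * (e + 1 : ℕ) - 1 := by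
      rw [Nat.cast_sub (by omega)]; push_cast; ring
    have hc0 : (0 : ℝ) ≤ ((2 * n - 1 : ℕ) : ℝ) - (2 * (e + 1) : ℕ) := by
      rw [← Nat.cast_sub (by omega)]; positivity
    have := tendsto_densityFactor_even (hm.mono (show e + 2 ≤ n by omega))
      (c := ((2 * n - 1 : ℕ) : ℝ) - (2 * (e + 1) : ℕ)) (γ := γ (e + 1)) (by linarith) hδk
      (by simpa using h1.add_const (γ (e + 1)))
      (by
        have := h2.add_const (δ (2 * (e + 1)))
        rw [zero_add] at this
        refine this.congr' ?_
        filter_upwards [eventually_gt_atTop 0] with s hs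
        field_simp
        ring)
    rw [if_pos ((posUpTo_iff_recA_pos m n).1 hm _ hk), mul_one]
    rw [show ((2 * n - 1 : ℕ) : ℝ) - (2 * (e + 1) : ℕ) + γ (e + 1) + 1 =
      γ (e + 1) + 2 * n - 2 * (e + 1 : ℕ) by rw [hc]; ring] at this
    refine this.congr fun s => ?_
    congr 2
    have e3 : (((2 * n - 1 : ℕ) : ℝ) - (2 * (e + 1) : ℕ)) + 1 = ((2 * (n - (e + 1)) : ℕ) : ℝ) := by
      rw [hc, Nat.cast_mul, Nat.cast_sub (by omega)]; push_cast; ring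
    rw [e3, Real.rpow_natCast, ← pow_mul]
    congr 1
    omega

/-! ### Recursion coefficients as coordinates -/

lemma continuous_mom {N : ℕ} (j : ℕ) : Continuous fun m : Fin N → ℝ => mom m j := by
  unfold mom
  split_ifs <;> fun_prop

lemma continuous_hankelDet {N : ℕ} (k : ℕ) : Continuous fun m : Fin N → ℝ => hankelDet m k :=
  Continuous.matrix_det (continuous_matrix fun _ _ => continuous_mom _)

lemma continuous_hankelShift {N : ℕ} (k i : ℕ) :
    Continuous fun m : Fin N → ℝ => hankelShift m k i := by
  refine Continuous.matrix_det (continuous_matrix fun r c => ?_)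
  simp only [Matrix.of_apply]
  split_ifs <;> exact continuous_mom _

lemma measurable_momLin_X_pow_mul_orthPoly {N : ℕ} (k i : ℕ) :
    Measurable fun m : Fin N → ℝ => momLin m (X ^ i * orthPoly m k) := by
  simp_rw [momLin_X_pow_mul_orthPoly]
  exact (continuous_hankelDet k).measurable.inv.mul (continuous_hankelShift k i).measurable

lemma measurable_recA {N : ℕ} (k : ℕ) : Measurable fun m : Fin N → ℝ => recA m k :=
  (measurable_momLin_X_pow_mul_orthPoly k k).div (measurable_momLin_X_pow_mul_orthPoly (k - 1) (k - 1))

lemma measurable_recB {N : ℕ} (k : ℕ) : Measurable fun m : Fin N → ℝ => recB m k := by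
  have h : ∀ k, Measurable fun m : Fin N → ℝ => recBSum m k := by
    rintro (_ | k)
    · exact measurable_const
    · exact (measurable_momLin_X_pow_mul_orthPoly k (k + 1)).div
        (measurable_momLin_X_pow_mul_orthPoly k k)
  exact (h k).sub (h (k - 1))

lemma natDegree_X_pow_mul_orthPoly_le {N : ℕ} (m : Fin N → ℝ) (k i : ℕ) :
    (X ^ i * orthPoly m k).natDegree ≤ i + k :=
  natDegree_mul_le.trans (add_le_add (by simp) (natDegree_orthPoly_le m k))

lemma momLin_X_pow_mul_orthPoly_congr {N N' : ℕ} (m : Fin N → ℝ) (m' : Fin N' → ℝ) {k i : ℕ}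
    (hi : k ≤ i) (h : ∀ j ≤ i + k, mom m j = mom m' j) :
    momLin m (X ^ i * orthPoly m k) = momLin m' (X ^ i * orthPoly m' k) := by
  rw [mom_congr_orthPoly m m' k fun j hj => h j (by omega)]
  exact momLin_congr _ _ (natDegree_X_pow_mul_orthPoly_le m' k i) h

lemma orthNorm_congr {N N' : ℕ} (m : Fin N → ℝ) (m' : Fin N' → ℝ) {k : ℕ}
    (h : ∀ j ≤ 2 * k, mom m j = mom m' j) : orthNorm m k = orthNorm m' k :=
  momLin_X_pow_mul_orthPoly_congr m m' le_rfl fun j hj => h j (by omega)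

lemma recA_congr {N N' : ℕ} (m : Fin N → ℝ) (m' : Fin N' → ℝ) {k : ℕ}
    (h : ∀ j ≤ 2 * k, mom m j = mom m' j) : recA m k = recA m' k := by
  rw [recA_eq, recA_eq, orthNorm_congr m m' h, orthNorm_congr m m' fun j hj => h j (by omega)]

lemma recBSum_congr {N N' : ℕ} (m : Fin N → ℝ) (m' : Fin N' → ℝ) {k : ℕ}
    (h : ∀ j ≤ 2 * k - 1, mom m j = mom m' j) : recBSum m k = recBSum m' k := by
  rcases k with _ | k
  · rfl
  · rw [recBSum_succ, recBSum_succ, orthNorm_congr m m' fun j hj => h j (by omega),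
      momLin_X_pow_mul_orthPoly_congr m m' (by omega) fun j hj => h j (by omega)]

lemma recB_congr {N N' : ℕ} (m : Fin N → ℝ) (m' : Fin N' → ℝ) {k : ℕ}
    (h : ∀ j ≤ 2 * k - 1, mom m j = mom m' j) : recB m k = recB m' k := by
  unfold recB
  rw [recBSum_congr m m' h, recBSum_congr m m' fun j hj => h j (by omega)]

/-- The sequence `b_1, a_1, b_2, a_2, …` of recursion coefficients. -/
noncomputable def recCoord {N : ℕ} (m : Fin N → ℝ) (k : ℕ) : ℝ :=
  if Even k then recA m (k / 2) else recB m ((k + 1) / 2)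

lemma measurable_recCoord {N : ℕ} (k : ℕ) : Measurable fun m : Fin N → ℝ => recCoord m k := by
  unfold recCoord
  split_ifs
  · exact measurable_recA _
  · exact measurable_recB _

lemma recCoord_two_mul {N : ℕ} (m : Fin N → ℝ) (k : ℕ) : recCoord m (2 * k) = recA m k := by
  simp [recCoord]

lemma recCoord_two_mul_sub_one {N : ℕ} (m : Fin N → ℝ) {k : ℕ} (hk : 1 ≤ k) :
    recCoord m (2 * k - 1) = recB m k := by
  obtain ⟨k, rfl⟩ := Nat.exists_eq_add_of_le' hk
  rw [recCoord, if_neg (by rw [Nat.not_even_iff]; omega)]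
  congr 1
  omega

lemma recCoord_congr {N N' : ℕ} (m : Fin N → ℝ) (m' : Fin N' → ℝ) {k : ℕ}
    (h : ∀ j ≤ k, mom m j = mom m' j) : recCoord m k = recCoord m' k := by
  unfold recCoord
  split_ifs with hk
  · exact recA_congr m m' fun j hj => h j (by omega)
  · exact recB_congr m m' fun j hj => h j (by rw [Nat.not_even_iff] at hk; omega)

lemma mom_snoc_of_le {N : ℕ} (x : Fin N → ℝ) (t : ℝ) {j : ℕ} (hj : j ≤ N) :
    mom (Fin.snoc x t : Fin (N + 1) → ℝ) j = mom x j := by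
  rcases j with _ | j
  · simp [mom]
  · have h1 := mom_succ (Fin.snoc x t : Fin (N + 1) → ℝ) (Fin.castSucc ⟨j, hj⟩)
    have h2 := mom_succ x ⟨j, hj⟩
    simp only [Fin.snoc_castSucc, Fin.val_castSucc] at h1 h2
    rw [h1, h2]

lemma mom_snoc_last {N : ℕ} (x : Fin N → ℝ) (t : ℝ) :
    mom (Fin.snoc x t : Fin (N + 1) → ℝ) (N + 1) = t := by
  have := mom_succ (Fin.snoc x t : Fin (N + 1) → ℝ) (Fin.last N)
  simpa using this

lemma mom_of_lt {N : ℕ} (x : Fin N → ℝ) {j : ℕ} (hj : N < j) : mom x j = 0 := by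
  rw [mom, if_neg (by omega), dif_neg (by omega)]

/-- The polynomial `X^i P_k` is monic of degree `N + 1` and `P_k` does not involve the appended
moment. On the right, the missing moment of `x` has the default value `0`. -/
lemma momLin_snoc {N : ℕ} (x : Fin N → ℝ) (t : ℝ) {k i : ℕ} (hk : PosUpTo x k)
    (hki : i + k = N + 1) (hi : k ≤ i) :
    momLin (Fin.snoc x t : Fin (N + 1) → ℝ) (X ^ i * orthPoly (Fin.snoc x t : Fin (N + 1) → ℝ) k) =
      momLin x (X ^ i * orthPoly x k) + t := by
  rw [mom_congr_orthPoly (Fin.snoc x t : Fin (N + 1) → ℝ) x k fun j hj =>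
      mom_snoc_of_le x t (by omega),
    momLin_sub_momLin _ x (d := N + 1) (hki ▸ natDegree_X_pow_mul_orthPoly_le x k i)
      fun j hj => mom_snoc_of_le x t (by omega), mom_snoc_last, mom_of_lt x (Nat.lt_succ_self N),
    ← hki, add_comm i k, coeff_X_pow_mul, hk.coeff_orthPoly le_rfl]
  ring

/-- This is the triangular structure of the coordinates. The slope is the inverse of `a_1 ⋯ a_j`
with `j = N / 2`, whichever parity `N` has. -/
lemma exists_recCoord_snoc {N : ℕ} (x : Fin N → ℝ) (hx : PosUpTo x (N / 2 + 1)) :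
    ∃ E : ℝ, ∀ t, recCoord (Fin.snoc x t : Fin (N + 1) → ℝ) (N + 1) =
      (t + E) / orthNorm x (N / 2) := by
  have hM := (hx (N / 2) (by omega)).ne'
  rcases Nat.even_or_odd' N with ⟨j, rfl | rfl⟩
  · rw [show 2 * j / 2 = j by omega] at hx hM ⊢
    refine ⟨momLin x (X ^ (j + 1) * orthPoly x j) - recBSum x j * orthNorm x j, fun t => ?_⟩
    have := recCoord_two_mul_sub_one (Fin.snoc x t : Fin (2 * j + 1) → ℝ) (k := j + 1) (by omega)
    rw [show 2 * (j + 1) - 1 = 2 * j + 1 by omega] at this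
    rw [this, recB, recBSum_succ, momLin_snoc x t (hx.mono (Nat.le_succ j)) (by omega) (by omega),
      Nat.add_sub_cancel,
      recBSum_congr (Fin.snoc x t : Fin (2 * j + 1) → ℝ) x fun i hi => mom_snoc_of_le x t (by omega),
      orthNorm_congr (Fin.snoc x t : Fin (2 * j + 1) → ℝ) x fun i hi => mom_snoc_of_le x t (by omega)]
    field_simp
    ring
  · rw [show (2 * j + 1) / 2 = j by omega] at hx hM ⊢
    refine ⟨orthNorm x (j + 1), fun t => ?_⟩
    have := recCoord_two_mul (Fin.snoc x t : Fin (2 * j + 1 + 1) → ℝ) (j + 1)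
    rw [show 2 * (j + 1) = 2 * j + 1 + 1 by omega] at this
    rw [this, recA_eq, orthNorm, momLin_snoc x t hx (by omega) (by omega), Nat.add_sub_cancel,
      orthNorm_congr (Fin.snoc x t : Fin (2 * j + 1 + 1) → ℝ) x fun i hi =>
        mom_snoc_of_le x t (by omega), add_comm t]
    rfl

lemma orthNorm_eq_prod {N : ℕ} {m : Fin N → ℝ} {k : ℕ} (hm : PosUpTo m k) :
    orthNorm m k = ∏ j ∈ Finset.Icc 1 k, recA m j := by
  induction k with
  | zero => simp [orthNorm_zero]
  | succ k ih =>
    rw [orthNorm_succ m (hm k (by omega)).ne', ih (hm.mono (Nat.le_succ k)),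
      Finset.prod_Icc_succ_top (by omega)]

lemma prod_Icc_even {M : Type*} [CommMonoid M] (N : ℕ) (f : ℕ → M) :
    ∏ k ∈ Finset.Icc 1 N, (if Even k then f k else 1) = ∏ j ∈ Finset.Icc 1 (N / 2), f (2 * j) := by
  induction N with
  | zero => simp
  | succ N ih =>
    rw [Finset.prod_Icc_succ_top (by omega), ih]
    rcases Nat.even_or_odd' N with ⟨j, rfl | rfl⟩
    · rw [if_neg (by rw [Nat.not_even_iff]; omega), mul_one,
        show (2 * j + 1) / 2 = 2 * j / 2 by omega]
    · rw [if_pos (by rw [Nat.even_iff]; omega), show (2 * j + 1) / 2 = j by omega,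
        show (2 * j + 1 + 1) / 2 = j + 1 by omega, Finset.prod_Icc_succ_top (by omega)]
      rfl

lemma lintegral_comp_add_div {ψ : ℝ → ENNReal} (hψ : Measurable ψ) (E : ℝ) {M : ℝ} (hM : 0 < M) :
    ∫⁻ t, ψ ((t + E) / M) = ENNReal.ofReal M * ∫⁻ c, ψ c := by
  rw [lintegral_add_right_eq_self (fun t => ψ (t / M)) E]
  have h := Real.map_volume_mul_left (inv_ne_zero hM.ne')
  rw [inv_inv, abs_of_pos hM] at h
  have := lintegral_map (μ := volume) hψ (measurable_const_mul M⁻¹)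
  rw [h, lintegral_smul_measure] at this
  simp_rw [div_eq_inv_mul]
  rw [← this, smul_eq_mul]

lemma lintegral_snoc {N : ℕ} {f : (Fin (N + 1) → ℝ) → ENNReal} (hf : Measurable f) :
    ∫⁻ m, f m = ∫⁻ x : Fin N → ℝ, ∫⁻ t : ℝ, f (Fin.snoc x t) := by
  have hp := volume_preserving_piFinSuccAbove (fun _ : Fin (N + 1) => ℝ) (Fin.last N)
  rw [← hp.symm.lintegral_comp hf, Measure.volume_eq_prod, lintegral_prod_symm]
  · refine lintegral_congr fun x => lintegral_congr fun t => ?_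
    congr 1
    simp [MeasurableEquiv.piFinSuccAbove, Fin.insertNthEquiv, Fin.insertNth_last']
  · exact (hf.comp (MeasurableEquiv.measurable _)).aemeasurable

/-- Integration in the coordinates given by the recursion coefficients. -/
lemma lintegral_prod_recCoord (N : ℕ) {ψ : ℕ → ℝ → ENNReal} (hψ : ∀ k, Measurable (ψ k))
    (h0 : ∀ k, Even k → ∀ c ≤ 0, ψ k c = 0) :
    ∫⁻ m : Fin N → ℝ, ∏ k ∈ Finset.Icc 1 N, ψ k (recCoord m k) =
      ∏ k ∈ Finset.Icc 1 N, ∫⁻ c, (if Even k then ENNReal.ofReal c else 1) ^ (N - k) * ψ k c := by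
  induction N generalizing ψ with
  | zero => simp [volume_pi]
  | succ N ih =>
    have hmeas : ∀ k : ℕ, Measurable fun c : ℝ => if Even k then ENNReal.ofReal c else 1 := by
      intro k; split_ifs <;> fun_prop
    rw [lintegral_snoc (f := fun m => ∏ k ∈ Finset.Icc 1 (N + 1), ψ k (recCoord m k))
      (Finset.measurable_prod _ fun k _ => (hψ k).comp (measurable_recCoord k))]
    have key : ∀ x : Fin N → ℝ, ∫⁻ t : ℝ, ∏ k ∈ Finset.Icc 1 (N + 1),
        ψ k (recCoord (Fin.snoc x t : Fin (N + 1) → ℝ) k) =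
        (∏ k ∈ Finset.Icc 1 N, ((if Even k then ENNReal.ofReal (recCoord x k) else 1) *
          ψ k (recCoord x k))) * ∫⁻ c, ψ (N + 1) c := by
      intro x
      have e1 : ∀ t : ℝ, ∏ k ∈ Finset.Icc 1 (N + 1),
          ψ k (recCoord (Fin.snoc x t : Fin (N + 1) → ℝ) k) =
          (∏ k ∈ Finset.Icc 1 N, ψ k (recCoord x k)) *
            ψ (N + 1) (recCoord (Fin.snoc x t : Fin (N + 1) → ℝ) (N + 1)) := fun t => by
        rw [Finset.prod_Icc_succ_top (by omega)]
        congr 1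
        refine Finset.prod_congr rfl fun k hk => ?_
        rw [recCoord_congr _ x fun j hj => mom_snoc_of_le x t
          (hj.trans (Finset.mem_Icc.1 hk).2)]
      simp_rw [e1]
      -- On strictly positive `x` the affine substitution produces the Jacobian `a_1 ⋯ a_{N/2}`,
      -- which is distributed over the even coordinates. Elsewhere some `a_k ≤ 0`, and `h0` makes
      -- both sides vanish.
      by_cases hx : PosUpTo x (N / 2 + 1)
      · obtain ⟨E, hE⟩ := exists_recCoord_snoc x hx
        have hM := hx (N / 2) (by omega)
        simp_rw [hE]
        have hcomp : Measurable fun t : ℝ => ψ (N + 1) ((t + E) / orthNorm x (N / 2)) :=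
          (hψ _).comp ((measurable_id.add_const E).div_const _)
        rw [lintegral_const_mul _ hcomp, lintegral_comp_add_div (hψ _) E hM,
          Finset.prod_mul_distrib, prod_Icc_even N fun k => ENNReal.ofReal (recCoord x k)]
        simp_rw [recCoord_two_mul]
        rw [← ENNReal.ofReal_prod_of_nonneg, ← orthNorm_eq_prod (hx.mono (Nat.le_succ _))]
        · ring
        · intro j hj
          exact ((posUpTo_iff_recA_pos x _).1 hx j (by simpa using hj)).le
      · rw [posUpTo_iff_recA_pos] at hx
        push Not at hx
        obtain ⟨k, hk, h⟩ := hx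
        have hk' := Finset.mem_Icc.1 hk
        have hz : ψ (2 * k) (recCoord x (2 * k)) = 0 := by
          rw [recCoord_two_mul]; exact h0 _ (even_two_mul k) _ h
        have hmem : 2 * k ∈ Finset.Icc 1 N := by simp; omega
        rw [Finset.prod_eq_zero hmem hz, Finset.prod_eq_zero hmem (by rw [hz, mul_zero])]
        simp
    simp_rw [key]
    have hprod : Measurable fun x : Fin N → ℝ => ∏ k ∈ Finset.Icc 1 N,
        ((if Even k then ENNReal.ofReal (recCoord x k) else 1) * ψ k (recCoord x k)) :=
      Finset.measurable_prod _ fun k _ => ((hmeas k).mul (hψ k)).comp (measurable_recCoord k)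
    -- The induction hypothesis is applied to the reweighted `ψ`. Each later coordinate adds one
    -- power of `c` at even `k`, whence the exponent `N - k`.
    rw [lintegral_mul_const _ hprod,
      ih (ψ := fun k c => (if Even k then ENNReal.ofReal c else 1) * ψ k c)
        (fun k => (hmeas k).mul (hψ k)) (fun k hk c hc => by rw [h0 k hk c hc, mul_zero]),
      Finset.prod_Icc_succ_top (by omega)]
    congr 1
    · refine Finset.prod_congr rfl fun k hk => lintegral_congr fun c => ?_
      rw [show N + 1 - k = N - k + 1 by have := (Finset.mem_Icc.1 hk).2; omega, pow_succ, mul_assoc]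
    · simp

/-! ### The limit density -/

open Classical in
/-- The density of the `k`-th recursion coefficient in the limit density, up to a power of `c`. -/
noncomputable def limitFactor (n : ℕ) (γ δ : ℕ → ℝ) (k : ℕ) (c : ℝ) : ℝ :=
  if Even k then δ k ^ (γ (k / 2) + 2 * n - 2 * (k / 2 : ℕ)) /
      Real.Gamma (γ (k / 2) + 2 * n - 2 * (k / 2 : ℕ)) * c ^ γ (k / 2) * Real.exp (-(δ k * c)) *
      if 0 < c then 1 else 0
  else √(δ k / Real.pi) * Real.exp (-(δ k * c ^ 2))

lemma limitDensity_eq_prod {n : ℕ} (hn : 1 ≤ n) (γ δ : ℕ → ℝ) (m : Fin (2 * n - 1) → ℝ) :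
    limitDensity n γ δ m =
      ∏ k ∈ Finset.Icc 1 (2 * n - 1), limitFactor n γ δ k (recCoord m k) := by
  rw [prod_Icc_odd_even hn]
  unfold limitDensity
  congr 1
  · refine Finset.prod_congr rfl fun k hk => ?_
    have hk1 := (Finset.mem_Icc.1 hk).1
    rw [limitFactor, if_neg (by rw [Nat.not_even_iff]; omega), recCoord_two_mul_sub_one m hk1]
  · refine Finset.prod_congr rfl fun k hk => ?_
    rw [limitFactor, if_pos (even_two_mul k), recCoord_two_mul, Nat.mul_div_cancel_left _ two_pos]

lemma measurable_limitFactor (n : ℕ) (γ δ : ℕ → ℝ) (k : ℕ) : Measurable (limitFactor n γ δ k) := by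
  unfold limitFactor
  split_ifs
  · refine Measurable.mul (by fun_prop) ?_
    exact Measurable.ite measurableSet_Ioi measurable_const measurable_const
  · fun_prop

lemma limitFactor_nonneg {n : ℕ} {γ δ : ℕ → ℝ} {k : ℕ} (hγ : Even k → -1 < γ (k / 2))
    (hδ : 0 < δ k) (hk : k < 2 * n) (c : ℝ) : 0 ≤ limitFactor n γ δ k c := by
  unfold limitFactor
  split_ifs with h h'
  · have hc : ((k / 2 : ℕ) : ℝ) + 1 ≤ n := by
      rw [Nat.even_iff] at h
      exact_mod_cast (by omega : k / 2 + 1 ≤ n)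
    have := Real.Gamma_pos_of_pos (s := γ (k / 2) + 2 * n - 2 * (k / 2 : ℕ)) (by linarith [hγ h])
    have := Real.rpow_pos_of_pos h' (γ (k / 2))
    have := Real.rpow_pos_of_pos hδ (γ (k / 2) + 2 * n - 2 * (k / 2 : ℕ))
    positivity
  · simp
  · positivity

/-- At `k = 2j` the Jacobian power raises the exponent to `γ j + 2n - 1 - 2j`, a gamma density of
shape `γ j + 2n - 2j`; this explains the constants in the limit. -/
lemma lintegral_limitFactor {n : ℕ} {γ δ : ℕ → ℝ} {k : ℕ} (hγ : Even k → -1 < γ (k / 2))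
    (hδ : 0 < δ k) (hk : k < 2 * n) :
    ∫⁻ c, (if Even k then ENNReal.ofReal c else 1) ^ (2 * n - 1 - k) *
      ENNReal.ofReal (limitFactor n γ δ k c) = 1 := by
  have h0 := limitFactor_nonneg hγ hδ hk
  unfold limitFactor at h0 ⊢
  split_ifs at h0 ⊢ with h
  · obtain ⟨j, rfl⟩ := even_iff_two_dvd.1 h
    simp only [Nat.mul_div_cancel_left _ two_pos] at *
    have hj : j + 1 ≤ n := by omega
    have hj' : (j : ℝ) + 1 ≤ n := by exact_mod_cast hj
    set r : ℝ := γ j + 2 * n - 2 * j with hr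
    have hr0 : 0 < r := by linarith [hγ h]
    have hG := Real.Gamma_pos_of_pos hr0
    have hD := Real.rpow_pos_of_pos hδ r
    have hint := Real.integral_rpow_mul_exp_neg_mul_Ioi hr0 hδ
    have hI : IntegrableOn (fun t : ℝ => t ^ (r - 1) * Real.exp (-(δ (2 * j) * t))) (Set.Ioi 0) := by
      have := integrableOn_rpow_mul_exp_neg_mul_rpow (p := 1) (s := r - 1) (b := δ (2 * j))
        (by linarith) one_pos hδ
      simpa only [Real.rpow_one, neg_mul] using this
    have e : ∀ c : ℝ, ENNReal.ofReal c ^ (2 * n - 1 - 2 * j) * ENNReal.ofReal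
        (δ (2 * j) ^ r / Real.Gamma r * c ^ γ j * Real.exp (-(δ (2 * j) * c)) *
          if 0 < c then 1 else 0) = (Set.Ioi (0 : ℝ)).indicator (fun c => ENNReal.ofReal
        (δ (2 * j) ^ r / Real.Gamma r * (c ^ (r - 1) * Real.exp (-(δ (2 * j) * c))))) c := by
      intro c
      by_cases hc : 0 < c
      · rw [Set.indicator_of_mem (show c ∈ Set.Ioi (0 : ℝ) from hc), if_pos hc,
          ← ENNReal.ofReal_pow hc.le, ← ENNReal.ofReal_mul (by positivity)]
        congr 1
        have : c ^ (r - 1) = c ^ (2 * n - 1 - 2 * j) * c ^ γ j := by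
          rw [← Real.rpow_natCast, ← Real.rpow_add hc, Nat.cast_sub (by omega),
            Nat.cast_sub (by omega)]
          congr 1
          push_cast
          rw [hr]; ring
        rw [this]
        ring
      · rw [Set.indicator_of_notMem (show c ∉ Set.Ioi (0 : ℝ) from hc), if_neg hc]
        simp
    simp_rw [e]
    rw [lintegral_indicator measurableSet_Ioi, ← ofReal_integral_eq_lintegral_ofReal
      (hI.const_mul _), integral_const_mul, hint, one_div, Real.inv_rpow hδ.le]
    · rw [show δ (2 * j) ^ r / Real.Gamma r * ((δ (2 * j) ^ r)⁻¹ * Real.Gamma r) = 1 by field_simp]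
      simp
    · filter_upwards [self_mem_ae_restrict measurableSet_Ioi] with t ht
      have : (0 : ℝ) < t := ht
      simp only [Pi.zero_apply]
      positivity
  · simp only [one_pow, one_mul]
    rw [← ofReal_integral_eq_lintegral_ofReal]
    · have := integral_gaussian (δ k)
      simp only [neg_mul] at this
      rw [integral_const_mul, this, ← Real.sqrt_mul (by positivity), div_mul_div_cancel₀',
        div_self Real.pi_pos.ne']
      · simp
      · exact hδ.ne'
    · have := (integrable_exp_neg_mul_sq hδ).const_mul √(δ k / Real.pi)
      simpa only [neg_mul] using this
    · exact Eventually.of_forall h0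

lemma mem_momentSpace_univ {n : ℕ} (hn : 1 ≤ n) {m : Fin (2 * n - 1) → ℝ} (hm : PosUpTo m n) :
    m ∈ momentSpace Set.univ (2 * n - 1) := by
  obtain ⟨e, rfl⟩ := Nat.exists_eq_add_of_le' hn
  obtain ⟨s, μ, hμ, h1, h2⟩ := (mem_nextMoments_odd_self_eventually hm).exists
  refine ⟨μ, ⟨hμ.isProb, by simp, hμ.integrable_pow⟩, fun i => ?_⟩
  rw [← mom_succ m i]
  by_cases hi : (i : ℕ) + 1 = 2 * e + 1
  · rw [hi, h2]
  · exact h1 _ (by simp; omega)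

lemma isDensityOn_limitDensity {n : ℕ} (hn : 1 ≤ n) {γ δ : ℕ → ℝ}
    (hγ : ∀ k ∈ Finset.Icc 1 (n - 1), -1 < γ k)
    (hδ : ∀ k ∈ Finset.Icc 1 (2 * n - 1), 0 < δ k) :
    IsDensityOn (momentSpace Set.univ (2 * n - 1)) (limitDensity n γ δ) := by
  have hγ' : ∀ k ∈ Finset.Icc 1 (2 * n - 1), Even k → -1 < γ (k / 2) := fun k hk h =>
    hγ _ (by rw [Nat.even_iff] at h; simp at hk ⊢; omega)
  have hlt : ∀ k ∈ Finset.Icc 1 (2 * n - 1), k < 2 * n := fun k hk => by simp at hk; omega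
  have hnn : ∀ k ∈ Finset.Icc 1 (2 * n - 1), ∀ c, 0 ≤ limitFactor n γ δ k c := fun k hk =>
    limitFactor_nonneg (hγ' k hk) (hδ k hk) (hlt k hk)
  refine ⟨?_, fun m => ?_, fun m hm => ?_, ?_⟩
  · rw [show limitDensity n γ δ = _ from funext (limitDensity_eq_prod hn γ δ)]
    exact Finset.measurable_prod _ fun k _ =>
      (measurable_limitFactor n γ δ k).comp (measurable_recCoord k)
  · rw [limitDensity_eq_prod hn]
    exact Finset.prod_nonneg fun k hk => hnn k hk _
  · exact limitDensity_eq_zero γ δ fun h => hm (mem_momentSpace_univ hn h)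
  · have e : ∀ m : Fin (2 * n - 1) → ℝ, ENNReal.ofReal (limitDensity n γ δ m) =
        ∏ k ∈ Finset.Icc 1 (2 * n - 1), ENNReal.ofReal (limitFactor n γ δ k (recCoord m k)) :=
      fun m => by
        rw [limitDensity_eq_prod hn, ENNReal.ofReal_prod_of_nonneg fun k hk => hnn k hk _]
    simp_rw [e]
    rw [lintegral_prod_recCoord (2 * n - 1)
      (ψ := fun k c => ENNReal.ofReal (limitFactor n γ δ k c))
      (fun k => (measurable_limitFactor n γ δ k).ennreal_ofReal)
      (fun k hk c hc => by simp [limitFactor, hk, hc.not_gt])]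
    exact Finset.prod_eq_one fun k hk =>
      lintegral_limitFactor (hγ' k hk) (hδ k hk) (hlt k hk)
theorem mainTheorem7 (n : ℕ) (hn : 1 ≤ n)
    (γ δ : ℕ → ℝ)
    (hγ : ∀ k ∈ Finset.Icc 1 (n - 1), -1 < γ k)
    (hδ : ∀ k ∈ Finset.Icc 1 (2 * n - 1), 0 < δ k)
    (γs δs : ℝ → ℕ → ℝ)
    (hγodd : ∀ k ∈ Finset.Icc 1 n,
      (fun s => γs s (2 * k - 1) - δ (2 * k - 1) * s ^ 2) =o[atTop] (fun _ => (1 : ℝ)))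
    (hδodd : ∀ k ∈ Finset.Icc 1 n,
      (fun s => δs s (2 * k - 1) - δ (2 * k - 1) * s ^ 2) =o[atTop] (fun _ => (1 : ℝ)))
    (hγeven : ∀ k ∈ Finset.Icc 1 (n - 1),
      (fun s => γs s (2 * k) - γ k) =o[atTop] (fun _ => (1 : ℝ)))
    (hδeven : ∀ k ∈ Finset.Icc 1 (n - 1),
      (fun s => δs s (2 * k) - δ (2 * k) * s ^ 2) =o[atTop] (fun s => s ^ 2)) :
    (∀ m : Fin (2 * n - 1) → ℝ,
      Tendsto (fun s : ℝ => momentDensity (-s) s (2 * n - 1) (γs s) (δs s) m) atTop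
        (𝓝 (limitDensity n γ δ m))) ∧
    IsDensityOn (momentSpace Set.univ (2 * n - 1)) (limitDensity n γ δ) := by
  exact ⟨tendsto_momentDensity hn hγ hδ hγodd hδodd hγeven hδeven,
    isDensityOn_limitDensity hn hγ hδ⟩
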